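/- Let $\mathbb F$ be a field and give $\mathbb F[x]$ the grading with $\deg x=1$. (1) Let $K=\bigoplus_{n\in\mathbb Z}K_n$ be a chain complex of free graded $\mathbb F[x]$-modules $K_n=\bigoplus_{s\in\mathbb Z}K_{n,s}$, whose differential $d\colon K_n\to K_{n-1}$ is $\mathbb F[x]$-linear and preserves the $\mathbb F[x]$-grading: $d(K_{n,s})\subset K_{n-1,s}$. Assume that for each $n$ the grading of $K_n$ is bounded below ($K_{n,s}=0$ for $s\ll0$) and that every $K_{n,s}$ is finite dimensional over $\mathbb F$. The short exact sequence $0\to K\{1\}\xrightarrow{x}K\to K/xK\to0$ induces an exact couple $$H(K)\xrightarrow{x}H(K)\to H(K/xK)\xrightarrow{\Delta}H(K).$$ For $r\ge1$ let $E^{(r)}(K)$ be the $E$-term of the exact couple obtained by deriving it $r-1$ times, bigraded by homological degree $n$ and $\mathbb F[x]$-degree $s$. Let $E^{(\infty)}(K)=Z^{\infty}/B^{\infty}$, where $Z^\infty\subset E^{(1)}(K)$ consists of the elements that survive to every page and $B^\infty$ of those that become zero on some page. Then: * $E^{(1)}(K)\cong H(K/xK)$ as bigraded $\mathbb F$-spaces.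 * $\{E^{(r)}(K)\}$ collapses locally to $E^{(\infty)}(K)$: for all $n,s\in\mathbb Z$ there is $r_{n,s}\ge1$ such that $E^{(r)}_{n,s}(K)\cong E^{(\infty)}_{n,s}(K)$ for all $r>r_{n,s}$. * $E^{(\infty)}(K)\cong H(K/(x-1)K)$, by an $\mathbb F$-linear isomorphism that preserves the homological grading and carries $\bigoplus_{s\le p}E^{(\infty)}_{n,s}(K)$ onto $\mathcal F^pH_n(K/(x-1)K)$ for all $n,p\in\mathbb Z$. Here $K/(x-1)K$ is filtered by the images $\mathcal F^p$ of the $K_{n,p}$, and $\mathcal F^pH_n$ consists of the classes of cycles in $\mathcal F^p$. (2) Let $(C,d,\mathcal F)$ be a filtered chain complex over $\mathbb F$: a chain complex $C=\bigoplus_{n\in\mathbb Z}C_n$ with ascending filtrations $\cdots\subset\mathcal F^pC_n\subset\mathcal F^{p+1}C_n\subset\cdots$ of each $C_n$ that are exhaustive, $\bigcup_p\mathcal F^pC_n=C_n$, and satisfy $d(\mathcal F^pC_n)\subset\mathcal F^pC_{n-1}$. Assume that (a) for each $n$ there is $p$ with $\mathcal F^pC_n=0$, and (b) $\dim_{\mathbb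 F}\mathcal F^pC_n<\infty$ for all $p,n$. Let $K=\bigoplus_{p\in\mathbb Z}\mathcal F^pC$ be its persistent chain complex, with $\mathcal F^pC$ in $\mathbb F[x]$-degree $p$ and $x$ acting by the inclusions $\mathcal F^pC\hookrightarrow\mathcal F^{p+1}C$. Then $K$ satisfies all assumptions of (1). Moreover, $K/xK$ is isomorphic, as a bigraded complex, to the associated graded complex $\bigoplus_p\mathcal F^pC/\mathcal F^{p-1}C$, and $K/(x-1)K$ is isomorphic, as a filtered chain complex, to $(C,d,\mathcal F)$. -/

import Mathlib

open Polynomial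
open scoped DirectSum

namespace PersistentSS

/-! ### Internal gradings -/

/-- `φ` is homogeneous (of some degree `δ`) for the gradings `G` and `G'`. -/
def IsHomog {F ι M N : Type*} [Field F] [Add ι] [AddCommGroup M] [Module F M] [AddCommGroup N]
    [Module F N] (G : ι → Submodule F M) (G' : ι → Submodule F N) (φ : M →ₗ[F] N) : Prop :=
  ∃ δ : ι, ∀ i, ∀ m ∈ G i, φ m ∈ G' (i + δ)

theorem internal_of {F ι M : Type*} [Field F] [DecidableEq ι] [AddCommGroup M] [Module F M]
    (G : ι → Submodule F M) (htop : iSup G = ⊤)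
    (h : ∀ i, ∃ N : Submodule F M, (∀ j, j ≠ i → G j ≤ N) ∧ ∀ m ∈ G i, m ∈ N → m = 0) :
    DirectSum.IsInternal G := by
  refine DirectSum.isInternal_submodule_of_iSupIndep_of_iSup_eq_top (fun i => ?_) htop
  obtain ⟨N, h1, h2⟩ := h i
  rw [Submodule.disjoint_def]
  exact fun m hm hm' => h2 m hm ((iSup₂_le h1 : (⨆ j, ⨆ _ : j ≠ i, G j) ≤ N) hm')

theorem exists_proj {F ι M : Type*} [Field F] [DecidableEq ι] [AddCommGroup M] [Module F M]
    {G : ι → Submodule F M} (hG : DirectSum.IsInternal G) (S : Set ι) :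
    ∃ π : M →ₗ[F] M, (∀ i ∈ S, ∀ m ∈ G i, π m = m) ∧ ∀ i, i ∉ S → ∀ m ∈ G i, π m = 0 := by
  classical
  let e := LinearEquiv.ofBijective (DirectSum.coeLinearMap G) hG
  let p : (⨁ i, G i) →ₗ[F] M :=
    DirectSum.toModule F ι M (fun i => if i ∈ S then (G i).subtype else 0)
  have key : ∀ i, ∀ m (hm : m ∈ G i), e.symm m = DirectSum.lof F ι (fun i => G i) i ⟨m, hm⟩ := by
    intro i m hm
    rw [LinearEquiv.symm_apply_eq]
    exact (DirectSum.coeLinearMap_lof G i ⟨m, hm⟩).symm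
  refine ⟨p ∘ₗ e.symm.toLinearMap, fun i hi m hm => ?_, fun i hi m hm => ?_⟩
  · simp [key i m hm, p, DirectSum.toModule_lof, hi]
  · simp [key i m hm, p, DirectSum.toModule_lof, hi]

theorem exists_sum {F ι M : Type*} [Field F] [DecidableEq ι] [AddCommGroup M] [Module F M]
    {G : ι → Submodule F M} (hG : DirectSum.IsInternal G) (m : M) :
    ∃ (s : Finset ι) (c : ι → M), (∀ i, c i ∈ G i) ∧ m = ∑ i ∈ s, c i := by
  classical
  have hm : m ∈ iSup G := by rw [hG.submodule_iSup_eq_top]; trivial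
  rw [Submodule.mem_iSup_iff_exists_finsupp] at hm
  obtain ⟨f, hf, rfl⟩ := hm
  exact ⟨f.support, f, hf, rfl⟩

/-- Coarsening an internal grading along a map of the index sets. -/
theorem internal_coarse {F ι κ M : Type*} [Field F] [DecidableEq ι] [DecidableEq κ]
    [AddCommGroup M] [Module F M] {G : ι → Submodule F M} (hG : DirectSum.IsInternal G)
    (q : ι → κ) : DirectSum.IsInternal (fun k => ⨆ i, ⨆ _ : q i = k, G i) := by
  refine internal_of _ ?_ fun k => ?_
  · rw [eq_top_iff, ← hG.submodule_iSup_eq_top]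
    exact iSup_le fun i => le_iSup_of_le (q i) (le_iSup₂_of_le i rfl le_rfl)
  · obtain ⟨π, h1, h2⟩ := exists_proj hG {i | q i = k}
    refine ⟨LinearMap.ker π, fun k' hk => iSup₂_le fun i hi m hm => ?_, fun m hm hm' => ?_⟩
    · exact h2 i (by simpa [hi] using hk) m hm
    · have : (⨆ i, ⨆ _ : q i = k, G i) ≤ LinearMap.ker (π - LinearMap.id) := by
        refine iSup₂_le fun i hi m hm => ?_
        simp [h1 i hi m hm]
      have h3 := this hm
      have h4 : π m = 0 := hm'
      simpa [h4] using h3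

theorem ker_homog {F ι M N : Type*} [Field F] [AddGroup ι] [DecidableEq ι] [AddCommGroup M]
    [Module F M] [AddCommGroup N] [Module F N] {G : ι → Submodule F M} {G' : ι → Submodule F N}
    (hG : DirectSum.IsInternal G) (hG' : DirectSum.IsInternal G') {φ : M →ₗ[F] N}
    (hφ : IsHomog G G' φ) : LinearMap.ker φ ≤ ⨆ i, G i ⊓ LinearMap.ker φ := by
  obtain ⟨δ, hδ⟩ := hφ
  intro m hm
  obtain ⟨s, c, hc, rfl⟩ := exists_sum hG m
  refine Submodule.sum_mem _ fun i hi => Submodule.mem_iSup_of_mem i ⟨hc i, ?_⟩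
  obtain ⟨π, h1, h2⟩ := exists_proj hG' {i + δ}
  have hm' : φ (∑ i ∈ s, c i) = 0 := hm
  have := congrArg π hm'
  rw [map_sum, map_sum, map_zero, Finset.sum_eq_single i] at this
  · rwa [h1 (i + δ) rfl _ (hδ i _ (hc i))] at this
  · intro j _ hj
    exact h2 (j + δ) (by simpa using hj) _ (hδ j _ (hc j))
  · exact fun h => absurd hi h

theorem range_homog {F ι M N : Type*} [Field F] [AddGroup ι] [DecidableEq ι] [AddCommGroup M]
    [Module F M] [AddCommGroup N] [Module F N] {G : ι → Submodule F M} {G' : ι → Submodule F N}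
    (hG : DirectSum.IsInternal G) {φ : M →ₗ[F] N}
    (hφ : IsHomog G G' φ) : LinearMap.range φ ≤ ⨆ i, G' i ⊓ LinearMap.range φ := by
  obtain ⟨δ, hδ⟩ := hφ
  rintro _ ⟨m, rfl⟩
  obtain ⟨s, c, hc, rfl⟩ := exists_sum hG m
  rw [map_sum]
  exact Submodule.sum_mem _ fun i hi =>
    Submodule.mem_iSup_of_mem (i + δ) ⟨hδ i _ (hc i), ⟨c i, rfl⟩⟩

theorem internal_sub {F ι M : Type*} [Field F] [DecidableEq ι] [AddCommGroup M] [Module F M]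
    {G : ι → Submodule F M} (hG : DirectSum.IsInternal G) {N : Submodule F M}
    (hN : N ≤ ⨆ i, G i ⊓ N) : DirectSum.IsInternal (fun i => (G i).comap N.subtype) := by
  refine internal_of _ ?_ fun i => ?_
  · apply Submodule.map_injective_of_injective N.injective_subtype
    rw [Submodule.map_iSup, Submodule.map_top, Submodule.range_subtype]
    apply le_antisymm (iSup_le fun i => Submodule.map_subtype_le N _)
    refine hN.trans (iSup_mono fun i => ?_)
    rw [Submodule.map_comap_subtype, inf_comm]
  · obtain ⟨π, h1, h2⟩ := exists_proj hG {i}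
    refine ⟨LinearMap.ker (π ∘ₗ N.subtype), fun j hj m hm => ?_, fun m hm hm' => ?_⟩
    · exact h2 j hj _ hm
    · have h3 := h1 i rfl _ hm
      have h4 : π (N.subtype m) = 0 := hm'
      rw [h4] at h3
      exact Subtype.ext h3.symm

theorem proj_mem {F ι M : Type*} [Field F] [AddCommGroup M] [Module F M]
    {G : ι → Submodule F M} {N : Submodule F M} (hN : N ≤ ⨆ i, G i ⊓ N) {S : Set ι}
    {π : M →ₗ[F] M} (h1 : ∀ i ∈ S, ∀ m ∈ G i, π m = m) (h2 : ∀ i, i ∉ S → ∀ m ∈ G i, π m = 0) :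
    N ≤ N.comap π := by
  refine hN.trans (iSup_le fun i m hm => ?_)
  by_cases hi : i ∈ S
  · rw [Submodule.mem_comap, h1 i hi m hm.1]; exact hm.2
  · rw [Submodule.mem_comap, h2 i hi m hm.1]; exact N.zero_mem

theorem internal_quot {F ι M : Type*} [Field F] [DecidableEq ι] [AddCommGroup M] [Module F M]
    {G : ι → Submodule F M} (hG : DirectSum.IsInternal G) {N : Submodule F M}
    (hN : N ≤ ⨆ i, G i ⊓ N) : DirectSum.IsInternal (fun i => (G i).map N.mkQ) := by
  refine internal_of _ ?_ fun i => ?_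
  · rw [← Submodule.map_iSup, hG.submodule_iSup_eq_top, Submodule.map_top, Submodule.range_mkQ]
  · obtain ⟨π, h1, h2⟩ := exists_proj hG {i}
    refine ⟨LinearMap.ker (N.mapQ N π (proj_mem hN h1 h2)), ?_, ?_⟩
    · rintro j hj _ ⟨m, hm, rfl⟩
      simp [h2 j hj m hm]
    · rintro _ ⟨m, hm, rfl⟩ hm'
      simpa [h1 i rfl m hm] using hm'

theorem internal_directSum {F ι : Type*} [Field F] [DecidableEq ι] (V : ι → Type*)
    [∀ i, AddCommGroup (V i)] [∀ i, Module F (V i)] :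
    DirectSum.IsInternal (fun i => LinearMap.range (DirectSum.lof F ι V i)) := by
  refine internal_of _ ?_ fun i => ⟨LinearMap.ker (DirectSum.component F ι V i), ?_, ?_⟩
  · rw [eq_top_iff]
    intro m _
    induction m using DirectSum.induction_on with
    | zero => exact Submodule.zero_mem _
    | of i v => exact Submodule.mem_iSup_of_mem i ⟨v, rfl⟩
    | add a b ha hb => exact Submodule.add_mem _ (ha trivial) (hb trivial)
  · rintro j hj _ ⟨v, rfl⟩
    exact (DirectSum.component.of F i j v).trans (dif_neg hj)
  · rintro _ ⟨v, rfl⟩ hv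
    have : DirectSum.component F ι V i (DirectSum.lof F ι V i v) = 0 := hv
    rw [DirectSum.component.lof_self] at this
    rw [this, map_zero]

theorem internal_equiv {F ι M N : Type*} [Field F] [DecidableEq ι] [AddCommGroup M] [Module F M]
    [AddCommGroup N] [Module F N] {G : ι → Submodule F M} (e : M ≃ₗ[F] N)
    (hG : DirectSum.IsInternal G) :
    DirectSum.IsInternal (fun i => (G i).map e.toLinearMap) := by
  refine internal_of _ ?_ fun i => ?_
  · rw [← Submodule.map_iSup, hG.submodule_iSup_eq_top, Submodule.map_top, LinearEquiv.range]
  · obtain ⟨π, h1, h2⟩ := exists_proj hG {i}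
    refine ⟨LinearMap.ker (π ∘ₗ e.symm.toLinearMap), ?_, ?_⟩
    · rintro j hj _ ⟨m, hm, rfl⟩
      simp [h2 j hj m hm]
    · rintro _ ⟨m, hm, rfl⟩ hm'
      simpa [h1 i rfl m hm] using hm'

/-! ### Homology of a differential -/

/-- The homology `ker d / im d` of an endomorphism `d` (used with `d ∘ d = 0`). -/
abbrev Homol {F M : Type*} [Field F] [AddCommGroup M] [Module F M] (d : M →ₗ[F] M) :=
  ↥(LinearMap.ker d) ⧸ (LinearMap.range d).comap (LinearMap.ker d).subtype

/-- The classes in `Homol d` represented by cycles that lie in the subspace `P`. -/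
def homolPart {F M : Type*} [Field F] [AddCommGroup M] [Module F M] (d : M →ₗ[F] M)
    (P : Submodule F M) : Submodule F (Homol d) :=
  (P.comap (LinearMap.ker d).subtype).map
    ((LinearMap.range d).comap (LinearMap.ker d).subtype).mkQ

theorem homol_internal {F ι M : Type*} [Field F] [AddGroup ι] [DecidableEq ι] [AddCommGroup M]
    [Module F M] {G : ι → Submodule F M} (hG : DirectSum.IsInternal G) {d : M →ₗ[F] M}
    (hd : IsHomog G G d) : DirectSum.IsInternal (fun i => homolPart d (G i)) := by
  refine internal_of _ ?_ fun i => ?_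
  · have := (internal_sub hG (ker_homog hG hG hd)).submodule_iSup_eq_top
    unfold homolPart
    rw [← Submodule.map_iSup, this, Submodule.map_top, Submodule.range_mkQ]
  · obtain ⟨π, h1, h2⟩ := exists_proj hG {i}
    have hr := proj_mem (range_homog hG hd) h1 h2
    refine ⟨LinearMap.ker (((LinearMap.range d).comap (LinearMap.ker d).subtype).mapQ
      (LinearMap.range d) (π ∘ₗ (LinearMap.ker d).subtype) fun m hm => hr hm), ?_, ?_⟩
    · rintro j hj _ ⟨m, hm, rfl⟩
      have : π (m : M) = 0 := h2 j hj _ hm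
      simp [this]
    · rintro _ ⟨m, hm, rfl⟩ hm'
      have : π (m : M) = m := h1 i rfl _ hm
      rw [LinearMap.mem_ker, Submodule.mkQ_apply, Submodule.mapQ_apply,
        Submodule.Quotient.mk_eq_zero] at hm'
      rw [Submodule.mkQ_apply, Submodule.Quotient.mk_eq_zero]
      simpa [this] using hm'

/-- The map that a chain map `φ` induces on homology. -/
def homolMap {F M N : Type*} [Field F] [AddCommGroup M] [Module F M] [AddCommGroup N] [Module F N]
    {d : M →ₗ[F] M} {d' : N →ₗ[F] N} (φ : M →ₗ[F] N) (h : ∀ m, d' (φ m) = φ (d m)) :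
    Homol d →ₗ[F] Homol d' :=
  Submodule.mapQ _ _
    (φ.restrict (p := LinearMap.ker d) (q := LinearMap.ker d') fun m hm => by
      rw [LinearMap.mem_ker] at hm ⊢
      rw [h, hm, map_zero])
    (by
      rintro ⟨m, hm⟩ ⟨k, hk⟩
      exact ⟨φ k, by rw [h, hk]; rfl⟩)

/-- A linear map `φ` that vanishes on the kernel of the surjection `π`, as a map on the target
of `π`: it sends `π p` to `φ p`. -/
noncomputable def descend {F P Q N : Type*} [Field F] [AddCommGroup P] [Module F P]
    [AddCommGroup Q] [Module F Q] [AddCommGroup N] [Module F N] (π : P →ₗ[F] Q)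
    (hπ : Function.Surjective π) (φ : P →ₗ[F] N) (h : LinearMap.ker π ≤ LinearMap.ker φ) :
    Q →ₗ[F] N :=
  (LinearMap.ker π).liftQ φ h ∘ₗ (π.quotKerEquivOfSurjective hπ).symm.toLinearMap

theorem descend_apply {F P Q N : Type*} [Field F] [AddCommGroup P] [Module F P]
    [AddCommGroup Q] [Module F Q] [AddCommGroup N] [Module F N] (π : P →ₗ[F] Q)
    (hπ : Function.Surjective π) (φ : P →ₗ[F] N) (h : LinearMap.ker π ≤ LinearMap.ker φ) (p : P) :
    descend π hπ φ h (π p) = φ p := by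
  have : (π.quotKerEquivOfSurjective hπ).symm (π p) = (LinearMap.ker π).mkQ p := by
    rw [LinearEquiv.symm_apply_eq]; rfl
  simp [descend, this]

/-! ### Exact couples and their spectral sequences -/

universe u v

/-- An exact couple of bigraded vector spaces and homogeneous maps
`A --f--> A --g--> E --h--> A`, exact at all three corners. -/
structure ExactCouple (F : Type u) [Field F] where
  A : Type v
  E : Type v
  [acgA : AddCommGroup A]
  [acgE : AddCommGroup E]
  [modA : Module F A]
  [modE : Module F E]
  grA : ℤ × ℤ → Submodule F A
  grE : ℤ × ℤ → Submodule F E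
  internalA : DirectSum.IsInternal grA
  internalE : DirectSum.IsInternal grE
  f : A →ₗ[F] A
  g : A →ₗ[F] E
  h : E →ₗ[F] A
  homog_f : IsHomog grA grA f
  homog_g : IsHomog grA grE g
  homog_h : IsHomog grE grA h
  exact_fg : Function.Exact f g
  exact_gh : Function.Exact g h
  exact_hf : Function.Exact h f

attribute [instance] ExactCouple.acgA ExactCouple.acgE ExactCouple.modA ExactCouple.modE

namespace ExactCouple

/-- The differential `d = g ∘ h` on `E`. -/
def d {F : Type u} [Field F] (C : ExactCouple.{u, v} F) : C.E →ₗ[F] C.E := C.g ∘ₗ C.h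

theorem homog_d {F : Type u} [Field F] (C : ExactCouple.{u, v} F) : IsHomog C.grE C.grE C.d := by
  obtain ⟨δ, hδ⟩ := C.homog_h
  obtain ⟨ε, hε⟩ := C.homog_g
  exact ⟨δ + ε, fun i m hm => by rw [← add_assoc]; exact hε _ _ (hδ _ _ hm)⟩

theorem h_g {F : Type u} [Field F] (C : ExactCouple.{u, v} F) (a : C.A) : C.h (C.g a) = 0 :=
  C.exact_gh.apply_apply_eq_zero a

theorem f_h {F : Type u} [Field F] (C : ExactCouple.{u, v} F) (e : C.E) : C.f (C.h e) = 0 :=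
  C.exact_hf.apply_apply_eq_zero e

/-- The map `a ↦ [g a]` from `A` to `H(E, d)`. -/
def gClass {F : Type u} [Field F] (C : ExactCouple.{u, v} F) : C.A →ₗ[F] Homol C.d :=
  Submodule.mkQ _ ∘ₗ C.g.codRestrict (LinearMap.ker C.d) fun a => by
    simp [d, C.h_g]

/-- `g'(f a) = [g a]`. -/
noncomputable def g' {F : Type u} [Field F] (C : ExactCouple.{u, v} F) :
    ↥(LinearMap.range C.f) →ₗ[F] Homol C.d :=
  descend C.f.rangeRestrict C.f.surjective_rangeRestrict C.gClass fun a ha => by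
    have ha' : C.f a = 0 := congrArg Subtype.val ha
    obtain ⟨e, rfl⟩ := (C.exact_hf a).1 ha'
    exact (Submodule.Quotient.mk_eq_zero _).2 ⟨e, rfl⟩

theorem g'_apply {F : Type u} [Field F] (C : ExactCouple.{u, v} F) (a : C.A) :
    C.g' (C.f.rangeRestrict a) = C.gClass a :=
  descend_apply _ _ _ _ _

theorem gClass_eq_zero {F : Type u} [Field F] (C : ExactCouple.{u, v} F) (a : C.A) :
    C.gClass a = 0 ↔ ∃ e, C.g (C.h e) = C.g a :=
  Submodule.Quotient.mk_eq_zero _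

/-- `h'[e] = h e`. -/
def h' {F : Type u} [Field F] (C : ExactCouple.{u, v} F) :
    Homol C.d →ₗ[F] ↥(LinearMap.range C.f) :=
  Submodule.liftQ _
    (C.h.restrict (p := LinearMap.ker C.d) (q := LinearMap.range C.f)
      fun e he => (C.exact_fg (C.h e)).1 he)
    (by
      rintro ⟨e, he⟩ ⟨k, hk⟩
      refine Subtype.ext ?_
      change C.h e = 0
      have hk' : C.g (C.h k) = e := hk
      rw [← hk', C.h_g])

/-- The derived exact couple: `A' = f(A)`, `E' = H(E, d)`, `f' = f|_{A'}`, `g'(f a) = [g a]`,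
`h'[e] = h e`, with the gradings induced on `f(A)` and on `H(E, d)`. -/
noncomputable def derived {F : Type u} [Field F] (C : ExactCouple.{u, v} F) :
    ExactCouple.{u, v} F where
  A := ↥(LinearMap.range C.f)
  E := Homol C.d
  grA i := (C.grA i).comap (LinearMap.range C.f).subtype
  grE i := homolPart C.d (C.grE i)
  internalA := internal_sub C.internalA (range_homog C.internalA C.homog_f)
  internalE := homol_internal C.internalE C.homog_d
  f := C.f.restrict fun a _ => ⟨a, rfl⟩
  g := C.g'
  h := C.h'
  homog_f := by
    obtain ⟨δ, hδ⟩ := C.homog_f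
    exact ⟨δ, fun i m hm => hδ i _ hm⟩
  homog_g := by
    obtain ⟨δ, hδ⟩ := C.homog_f
    obtain ⟨ε, hε⟩ := C.homog_g
    refine ⟨-δ + ε, ?_⟩
    rintro i ⟨_, a, rfl⟩ hm
    -- replace `a` by its component of degree `i - δ`
    obtain ⟨s, c, hc, hs⟩ := exists_sum C.internalA a
    obtain ⟨π, h1, h2⟩ := exists_proj C.internalA {i}
    obtain ⟨ρ, k1, k2⟩ := exists_proj C.internalA {i - δ}
    have hρ : ∀ j, ∀ m ∈ C.grA j, ρ m ∈ C.grA (i - δ) := by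
      intro j m hm
      by_cases hj : j = i - δ
      · rw [k1 j hj m hm]; exact hj ▸ hm
      · rw [k2 j hj m hm]; exact Submodule.zero_mem _
    have hmem : ρ a ∈ C.grA (i - δ) := by
      rw [hs, map_sum]
      exact Submodule.sum_mem _ fun j _ => hρ j _ (hc j)
    have hcomm : C.f (ρ a) = π (C.f a) := by
      rw [hs]
      simp only [map_sum]
      refine Finset.sum_congr rfl fun j _ => ?_
      by_cases hj : j = i - δ
      · rw [k1 j hj _ (hc j), h1 (j + δ) (by rw [hj]; simp) _ (hδ j _ (hc j))]
      · rw [k2 j hj _ (hc j), map_zero, h2 (j + δ) (fun h => hj ?_) _ (hδ j _ (hc j))]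
        exact eq_sub_of_add_eq h
    have heq : C.f (ρ a) = C.f a := by
      rw [hcomm]; exact h1 i rfl _ hm
    have : (⟨C.f a, a, rfl⟩ : ↥(LinearMap.range C.f)) = C.f.rangeRestrict (ρ a) :=
      Subtype.ext heq.symm
    rw [this, C.g'_apply]
    refine ⟨_, ?_, rfl⟩
    have h3 := hε _ _ hmem
    rwa [sub_eq_add_neg, add_assoc] at h3
  homog_h := by
    obtain ⟨δ, hδ⟩ := C.homog_h
    refine ⟨δ, ?_⟩
    rintro i _ ⟨m, hm, rfl⟩
    exact hδ i _ hm
  exact_fg := by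
    rintro ⟨_, a, rfl⟩
    change C.g' (C.f.rangeRestrict a) = 0 ↔ _
    rw [C.g'_apply, C.gClass_eq_zero]
    constructor
    · rintro ⟨e, he⟩
      have h0 : C.g (a - C.h e) = 0 := by rw [map_sub, he, sub_self]
      obtain ⟨b, hb⟩ := (C.exact_fg _).1 h0
      refine ⟨⟨C.f b, b, rfl⟩, Subtype.ext ?_⟩
      change C.f (C.f b) = C.f a
      rw [hb, map_sub, C.f_h, sub_zero]
    · rintro ⟨⟨_, b, rfl⟩, hb⟩
      have hb' : C.f (C.f b) = C.f a := congrArg Subtype.val hb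
      have h0 : C.f (a - C.f b) = 0 := by rw [map_sub, hb', sub_self]
      obtain ⟨e, he⟩ := (C.exact_hf _).1 h0
      refine ⟨e, ?_⟩
      rw [he, map_sub, C.exact_fg.apply_apply_eq_zero, sub_zero]
  exact_gh := by
    intro q
    obtain ⟨⟨e, he⟩, rfl⟩ := Submodule.mkQ_surjective _ q
    constructor
    · intro h0
      have h0' : C.h e = 0 := congrArg Subtype.val h0
      obtain ⟨a, rfl⟩ := (C.exact_gh e).1 h0'
      exact ⟨C.f.rangeRestrict a, C.g'_apply a⟩
    · rintro ⟨⟨_, a, rfl⟩, hb⟩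
      rw [← hb]
      change C.h' (C.g' (C.f.rangeRestrict a)) = 0
      rw [C.g'_apply]
      exact Subtype.ext (C.h_g a)
  exact_hf := by
    rintro ⟨a, ha⟩
    constructor
    · intro h0
      have h0' : C.f a = 0 := congrArg Subtype.val h0
      obtain ⟨e, rfl⟩ := (C.exact_hf a).1 h0'
      exact ⟨Submodule.mkQ _ ⟨e, (C.exact_fg _).2 ha⟩, rfl⟩
    · rintro ⟨q, hq⟩
      obtain ⟨⟨e, he⟩, rfl⟩ := Submodule.mkQ_surjective _ q
      have hq' : C.h e = a := congrArg Subtype.val hq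
      exact Subtype.ext (by change C.f a = 0; rw [← hq', C.f_h])

/-- The couple derived `r - 1` times; its `E` is the page `E^(r)`, for `r ≥ 1`. -/
noncomputable def page {F : Type u} [Field F] (C : ExactCouple.{u, v} F) (r : ℕ) :
    ExactCouple.{u, v} F :=
  derived^[r - 1] C

/-- The map that sends a `d`-cycle to its class in `E' = H(E, d)`. -/
noncomputable def toDerived {F : Type u} [Field F] (C : ExactCouple.{u, v} F) :
    ↥(LinearMap.ker C.d) →ₗ[F] C.derived.E :=
  ((LinearMap.range C.d).comap (LinearMap.ker C.d).subtype).mkQ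

/-- `cyc k C ⊆ E` are the elements that survive `k` times: all of `E` if `k = 0`, and else
the `d`-cycles whose class in `E' = H(E, d)` survives `k - 1` times. -/
noncomputable def cyc {F : Type u} [Field F] : ℕ → (C : ExactCouple.{u, v} F) → Submodule F C.E
  | 0, _ => ⊤
  | k + 1, C => ((cyc k C.derived).comap C.toDerived).map (LinearMap.ker C.d).subtype

/-- `bdy k C ⊆ E` are the elements that become zero after `k` steps: zero if `k = 0`, and else
the `d`-cycles whose class in `E' = H(E, d)` becomes zero after `k - 1` steps. -/
noncomputable def bdy {F : Type u} [Field F] : ℕ → (C : ExactCouple.{u, v} F) → Submodule F C.E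
  | 0, _ => ⊥
  | k + 1, C => ((bdy k C.derived).comap C.toDerived).map (LinearMap.ker C.d).subtype

/-- The permanent cycles in `E`. -/
noncomputable def cycInf {F : Type u} [Field F] (C : ExactCouple.{u, v} F) : Submodule F C.E :=
  ⨅ k, cyc k C

/-- The eventual boundaries in `E`. -/
noncomputable def bdyInf {F : Type u} [Field F] (C : ExactCouple.{u, v} F) : Submodule F C.E :=
  ⨆ k, bdy k C

/-- The limit page `E^(∞) = Z^∞ / B^∞`. -/
abbrev EInf {F : Type u} [Field F] (C : ExactCouple.{u, v} F) :=
  ↥C.cycInf ⧸ C.bdyInf.comap C.cycInf.subtype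

/-- The bihomogeneous components of `E^(∞)`. -/
noncomputable def grEInf {F : Type u} [Field F] (C : ExactCouple.{u, v} F) (i : ℤ × ℤ) :
    Submodule F C.EInf :=
  ((C.grE i).comap C.cycInf.subtype).map (C.bdyInf.comap C.cycInf.subtype).mkQ

end ExactCouple

/-! ### Complexes -/

/-- A chain complex of graded vector spaces, as one space `V` with pieces `gr (n, s)` of
homological degree `n` and internal degree `s`. -/
structure BigradedComplex (F V : Type*) [Field F] [AddCommGroup V] [Module F V] where
  gr : ℤ × ℤ → Submodule F V
  internal : DirectSum.IsInternal gr
  d : V →ₗ[F] V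
  d_d : ∀ v, d (d v) = 0
  d_mem : ∀ n s, ∀ v ∈ gr (n, s), d v ∈ gr (n - 1, s)

/-- A chain complex of graded `F[X]`-modules, `X` of degree `1`, whose differential is
`F[X]`-linear and preserves the internal degree. -/
structure GradedComplex (F K : Type*) [Field F] [AddCommGroup K] [Module F K] [Module F[X] K]
    [IsScalarTower F F[X] K] extends BigradedComplex F K where
  X_mem : ∀ n s, ∀ v ∈ gr (n, s), (X : F[X]) • v ∈ gr (n, s + 1)
  d_smul : ∀ (p : F[X]) (v : K), d (p • v) = p • d v

/-- A filtered chain complex: `C = ⨁ₙ Cₙ` with a differential of degree `-1` and an ascending,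
exhaustive `ℤ`-filtration `fil p n = 𝓕ᵖCₙ` of each `Cₙ` which the differential respects. -/
structure FilteredComplex (F C : Type*) [Field F] [AddCommGroup C] [Module F C] where
  hom : ℤ → Submodule F C
  internal : DirectSum.IsInternal hom
  d : C →ₗ[F] C
  d_d : ∀ v, d (d v) = 0
  d_mem : ∀ n, ∀ v ∈ hom n, d v ∈ hom (n - 1)
  fil : ℤ → ℤ → Submodule F C
  fil_mono : ∀ n, Monotone fun p => fil p n
  fil_exhaustive : ∀ n, ⨆ p, fil p n = hom n
  d_fil : ∀ p n, ∀ v ∈ fil p n, d v ∈ fil p (n - 1)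

/-- Isomorphism of bigraded complexes. -/
def BigradedComplex.Isomorphic {F V W : Type*} [Field F] [AddCommGroup V] [Module F V]
    [AddCommGroup W] [Module F W] (𝒱 : BigradedComplex F V) (𝒲 : BigradedComplex F W) : Prop :=
  ∃ e : V ≃ₗ[F] W, (∀ v, e (𝒱.d v) = 𝒲.d (e v)) ∧
    ∀ i, (𝒱.gr i).map e.toLinearMap = 𝒲.gr i

/-- Isomorphism of filtered chain complexes. -/
def FilteredComplex.Isomorphic {F V W : Type*} [Field F] [AddCommGroup V] [Module F V]
    [AddCommGroup W] [Module F W] (𝒱 : FilteredComplex F V) (𝒲 : FilteredComplex F W) : Prop :=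
  ∃ e : V ≃ₗ[F] W, (∀ v, e (𝒱.d v) = 𝒲.d (e v)) ∧
    (∀ n, (𝒱.hom n).map e.toLinearMap = 𝒲.hom n) ∧
    ∀ p n, (𝒱.fil p n).map e.toLinearMap = 𝒲.fil p n

namespace GradedComplex

/-- In each homological degree the grading is bounded below. -/
def BoundedBelow {F K : Type*} [Field F] [AddCommGroup K] [Module F K] [Module F[X] K]
    [IsScalarTower F F[X] K] (𝒦 : GradedComplex F K) : Prop :=
  ∀ n, ∃ b : ℤ, ∀ s < b, 𝒦.gr (n, s) = ⊥

/-- Every bihomogeneous component is finite dimensional. -/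
def LocallyFinite {F K : Type*} [Field F] [AddCommGroup K] [Module F K] [Module F[X] K]
    [IsScalarTower F F[X] K] (𝒦 : GradedComplex F K) : Prop :=
  ∀ n s, FiniteDimensional F (𝒦.gr (n, s))

/-- The `F`-subspace `pK`, for a polynomial `p`. -/
noncomputable def mulRange (F K : Type*) [Field F] [AddCommGroup K] [Module F K] [Module F[X] K]
    [IsScalarTower F F[X] K] (p : F[X]) : Submodule F K :=
  LinearMap.range (Algebra.lsmul F F K p)

/-- The differential that `d` induces on `K/pK`. -/
noncomputable def dQuot {F K : Type*} [Field F] [AddCommGroup K] [Module F K] [Module F[X] K]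
    [IsScalarTower F F[X] K] (𝒦 : GradedComplex F K) (p : F[X]) :
    (K ⧸ mulRange F K p) →ₗ[F] (K ⧸ mulRange F K p) :=
  Submodule.mapQ _ _ 𝒦.d (by
    rintro _ ⟨k, rfl⟩
    exact ⟨𝒦.d k, (𝒦.d_smul p k).symm⟩)

theorem X_homog {F K : Type*} [Field F] [AddCommGroup K] [Module F K] [Module F[X] K]
    [IsScalarTower F F[X] K] (𝒦 : GradedComplex F K) :
    IsHomog 𝒦.gr 𝒦.gr (Algebra.lsmul F F K (X : F[X])) :=
  ⟨(0, 1), fun i v hv => by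
    have h := 𝒦.X_mem i.1 i.2 v hv
    rw [show i + (0, 1) = (i.1, i.2 + 1) from Prod.ext (add_zero _) rfl]
    exact h⟩

theorem d_homog {F V : Type*} [Field F] [AddCommGroup V] [Module F V]
    (𝒱 : BigradedComplex F V) : IsHomog 𝒱.gr 𝒱.gr 𝒱.d :=
  ⟨(-1, 0), fun i v hv => by
    have h := 𝒱.d_mem i.1 i.2 v hv
    rw [show i + (-1, 0) = (i.1 - 1, i.2) from Prod.ext rfl (add_zero _)]
    exact h⟩

/-- The complex `K/XK`, with the induced bigrading. -/
noncomputable def modX {F K : Type*} [Field F] [AddCommGroup K] [Module F K] [Module F[X] K]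
    [IsScalarTower F F[X] K] (𝒦 : GradedComplex F K) :
    BigradedComplex F (K ⧸ mulRange F K (X : F[X])) where
  gr i := (𝒦.gr i).map (mulRange F K X).mkQ
  internal := internal_quot 𝒦.internal (range_homog 𝒦.internal 𝒦.X_homog)
  d := 𝒦.dQuot X
  d_d v := by
    obtain ⟨k, rfl⟩ := Submodule.mkQ_surjective _ v
    simp [dQuot, 𝒦.d_d]
  d_mem n s := by
    rintro _ ⟨k, hk, rfl⟩
    exact ⟨𝒦.d k, 𝒦.d_mem n s k hk, rfl⟩

/-- The complex `K/(X-1)K`. As `X - 1` is inhomogeneous, only the homological grading survives;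
the internal grading becomes the filtration by the images of the components of `K`. -/
noncomputable def modXSubOne {F K : Type*} [Field F] [AddCommGroup K] [Module F K]
    [Module F[X] K] [IsScalarTower F F[X] K] (𝒦 : GradedComplex F K) :
    FilteredComplex F (K ⧸ mulRange F K (X - 1 : F[X])) where
  hom n := (⨆ i : ℤ × ℤ, ⨆ _ : i.1 = n, 𝒦.gr i).map (mulRange F K (X - 1)).mkQ
  internal := by
    have hc := internal_coarse 𝒦.internal Prod.fst
    refine internal_quot hc (range_homog hc ⟨0, fun n v hv => ?_⟩)
    rw [add_zero]
    suffices h : (⨆ i : ℤ × ℤ, ⨆ _ : i.1 = n, 𝒦.gr i) ≤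
        (⨆ i : ℤ × ℤ, ⨆ _ : i.1 = n, 𝒦.gr i).comap (Algebra.lsmul F F K (X - 1 : F[X])) from h hv
    refine iSup₂_le fun i hi v hv => ?_
    change (X - 1 : F[X]) • v ∈ (⨆ i : ℤ × ℤ, ⨆ _ : i.1 = n, 𝒦.gr i)
    rw [sub_smul, one_smul]
    exact Submodule.sub_mem _
      (Submodule.mem_iSup_of_mem (i.1, i.2 + 1) (Submodule.mem_iSup_of_mem hi (𝒦.X_mem _ _ v hv)))
      (Submodule.mem_iSup_of_mem i (Submodule.mem_iSup_of_mem hi hv))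
  d := 𝒦.dQuot (X - 1)
  d_d v := by
    obtain ⟨k, rfl⟩ := Submodule.mkQ_surjective _ v
    simp [dQuot, 𝒦.d_d]
  d_mem n := by
    rintro _ ⟨k, hk, rfl⟩
    refine ⟨𝒦.d k, ?_, rfl⟩
    suffices h : (⨆ i : ℤ × ℤ, ⨆ _ : i.1 = n, 𝒦.gr i) ≤
        (⨆ i : ℤ × ℤ, ⨆ _ : i.1 = n - 1, 𝒦.gr i).comap 𝒦.d from h hk
    refine iSup₂_le fun i hi v hv => ?_
    exact Submodule.mem_iSup_of_mem (i.1 - 1, i.2)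
      (Submodule.mem_iSup_of_mem (by simp [hi]) (𝒦.d_mem _ _ v hv))
  fil p n := (𝒦.gr (n, p)).map (mulRange F K (X - 1)).mkQ
  fil_mono n := by
    refine monotone_int_of_le_succ fun p => ?_
    rintro _ ⟨k, hk, rfl⟩
    refine ⟨(X : F[X]) • k, 𝒦.X_mem _ _ _ hk, (Submodule.Quotient.eq _).2 ⟨k, ?_⟩⟩
    change (X - 1 : F[X]) • k = _
    rw [sub_smul, one_smul]
  fil_exhaustive n := by
    rw [← Submodule.map_iSup]
    congr 1
    apply le_antisymm
    · exact iSup_le fun p => le_iSup₂_of_le (n, p) rfl le_rfl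
    · refine iSup₂_le ?_
      rintro ⟨_, p⟩ rfl
      exact le_iSup (fun p => 𝒦.gr (_, p)) p
  d_fil p n := by
    rintro _ ⟨k, hk, rfl⟩
    exact ⟨𝒦.d k, 𝒦.d_mem n p k hk, rfl⟩

/-! The exact couple of the short exact sequence `0 → K{1} --X--> K → K/XK → 0`. -/

theorem X_injective (F K : Type*) [Field F] [AddCommGroup K] [Module F K] [Module F[X] K]
    [IsScalarTower F F[X] K] [Module.Free F[X] K] :
    Function.Injective (Algebra.lsmul F F K (X : F[X])) := by
  intro a b hab
  exact smul_right_injective K (Polynomial.X_ne_zero (R := F)) hab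

/-- The elements of `K` that become cycles in `K/XK`. -/
noncomputable def preCyc {F K : Type*} [Field F] [AddCommGroup K] [Module F K] [Module F[X] K]
    [IsScalarTower F F[X] K] (𝒦 : GradedComplex F K) : Submodule F K :=
  (mulRange F K (X : F[X])).comap 𝒦.d

/-- The map `k ↦ X⁻¹ d k`, defined if `d k ∈ XK`. -/
noncomputable def divX {F K : Type*} [Field F] [AddCommGroup K] [Module F K] [Module F[X] K]
    [IsScalarTower F F[X] K] [Module.Free F[X] K] (𝒦 : GradedComplex F K) :
    ↥𝒦.preCyc →ₗ[F] K :=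
  (LinearEquiv.ofInjective _ (X_injective F K)).symm.toLinearMap ∘ₗ
    𝒦.d.restrict (p := 𝒦.preCyc) (q := mulRange F K (X : F[X])) fun _ hk => hk

theorem X_smul_divX {F K : Type*} [Field F] [AddCommGroup K] [Module F K] [Module F[X] K]
    [IsScalarTower F F[X] K] [Module.Free F[X] K] (𝒦 : GradedComplex F K) (k : 𝒦.preCyc) :
    (X : F[X]) • 𝒦.divX k = 𝒦.d k :=
  congrArg Subtype.val ((LinearEquiv.ofInjective _ (X_injective F K)).apply_symm_apply
    (𝒦.d.restrict (p := 𝒦.preCyc) (q := mulRange F K (X : F[X])) (fun _ hk => hk) k))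

theorem X_cancel {F K : Type*} [Field F] [AddCommGroup K] [Module F K] [Module F[X] K]
    [IsScalarTower F F[X] K] [Module.Free F[X] K] {a b : K} (h : (X : F[X]) • a = (X : F[X]) • b) :
    a = b :=
  X_injective F K h

theorem d_divX {F K : Type*} [Field F] [AddCommGroup K] [Module F K] [Module F[X] K]
    [IsScalarTower F F[X] K] [Module.Free F[X] K] (𝒦 : GradedComplex F K) (k : 𝒦.preCyc) :
    𝒦.d (𝒦.divX k) = 0 :=
  X_cancel (F := F) (by rw [← 𝒦.d_smul, 𝒦.X_smul_divX, 𝒦.d_d, smul_zero])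

/-- The map `k ↦ [X⁻¹ d k]` to `H(K)`. -/
noncomputable def divXClass {F K : Type*} [Field F] [AddCommGroup K] [Module F K] [Module F[X] K]
    [IsScalarTower F F[X] K] [Module.Free F[X] K] (𝒦 : GradedComplex F K) :
    ↥𝒦.preCyc →ₗ[F] Homol 𝒦.d :=
  Submodule.mkQ _ ∘ₗ 𝒦.divX.codRestrict (LinearMap.ker 𝒦.d) 𝒦.d_divX

/-- The map `k ↦ [k + XK]` to `H(K/XK)`. -/
noncomputable def preCycClass {F K : Type*} [Field F] [AddCommGroup K] [Module F K]
    [Module F[X] K] [IsScalarTower F F[X] K] (𝒦 : GradedComplex F K) :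
    ↥𝒦.preCyc →ₗ[F] Homol 𝒦.modX.d :=
  Submodule.mkQ _ ∘ₗ (mulRange F K (X : F[X])).mkQ.restrict (p := 𝒦.preCyc)
    (q := LinearMap.ker 𝒦.modX.d) fun _ hk => (Submodule.Quotient.mk_eq_zero _).2 hk

theorem preCycClass_surjective {F K : Type*} [Field F] [AddCommGroup K] [Module F K]
    [Module F[X] K] [IsScalarTower F F[X] K] (𝒦 : GradedComplex F K) :
    Function.Surjective 𝒦.preCycClass := by
  intro q
  obtain ⟨⟨y, hy⟩, rfl⟩ := Submodule.mkQ_surjective _ q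
  obtain ⟨k, rfl⟩ := Submodule.mkQ_surjective _ y
  exact ⟨⟨k, (Submodule.Quotient.mk_eq_zero (mulRange F K (X : F[X]))).1 hy⟩, rfl⟩

theorem preCycClass_eq_zero {F K : Type*} [Field F] [AddCommGroup K] [Module F K]
    [Module F[X] K] [IsScalarTower F F[X] K] (𝒦 : GradedComplex F K) (k : 𝒦.preCyc) :
    𝒦.preCycClass k = 0 ↔ ∃ l m : K, (k : K) = 𝒦.d l + (X : F[X]) • m := by
  refine (Submodule.Quotient.mk_eq_zero _).trans ⟨?_, ?_⟩
  · rintro ⟨y, hy⟩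
    obtain ⟨l, rfl⟩ := Submodule.mkQ_surjective _ y
    have hy' : (Submodule.Quotient.mk (𝒦.d l) : K ⧸ mulRange F K (X : F[X])) =
      Submodule.Quotient.mk (k : K) := hy
    obtain ⟨m, hm⟩ := (Submodule.Quotient.eq _).1 hy'.symm
    refine ⟨l, m, ?_⟩
    have hm' : (X : F[X]) • m = (k : K) - 𝒦.d l := hm
    rw [hm']; abel
  · rintro ⟨l, m, h⟩
    refine ⟨Submodule.Quotient.mk l, ?_⟩
    refine ((Submodule.Quotient.eq _).2 ⟨m, ?_⟩ :
      (Submodule.Quotient.mk (k : K) : K ⧸ mulRange F K (X : F[X])) =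
        Submodule.Quotient.mk (𝒦.d l)).symm
    change (X : F[X]) • m = _
    rw [h]; abel

theorem divXClass_eq_zero {F K : Type*} [Field F] [AddCommGroup K] [Module F K]
    [Module F[X] K] [IsScalarTower F F[X] K] [Module.Free F[X] K] (𝒦 : GradedComplex F K)
    (k : 𝒦.preCyc) : 𝒦.divXClass k = 0 ↔ ∃ l : K, 𝒦.d l = 𝒦.divX k :=
  Submodule.Quotient.mk_eq_zero _

/-- The connecting homomorphism `H(K/XK) → H(K)`, `[k + XK] ↦ [X⁻¹ d k]`. -/
noncomputable def connecting {F K : Type*} [Field F] [AddCommGroup K] [Module F K]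
    [Module F[X] K] [IsScalarTower F F[X] K] [Module.Free F[X] K] (𝒦 : GradedComplex F K) :
    Homol 𝒦.modX.d →ₗ[F] Homol 𝒦.d :=
  descend 𝒦.preCycClass 𝒦.preCycClass_surjective 𝒦.divXClass fun k hk => by
    obtain ⟨l, m, h⟩ := (𝒦.preCycClass_eq_zero k).1 hk
    refine (𝒦.divXClass_eq_zero k).2 ⟨m, X_cancel (F := F) ?_⟩
    rw [𝒦.X_smul_divX, h, map_add, 𝒦.d_d, zero_add, 𝒦.d_smul]

theorem connecting_apply {F K : Type*} [Field F] [AddCommGroup K] [Module F K]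
    [Module F[X] K] [IsScalarTower F F[X] K] [Module.Free F[X] K] (𝒦 : GradedComplex F K)
    (k : 𝒦.preCyc) : 𝒦.connecting (𝒦.preCycClass k) = 𝒦.divXClass k :=
  descend_apply _ _ _ _ _

/-- The exact couple `H(K) --X--> H(K) --> H(K/XK) --Δ--> H(K)` of a complex of free graded
`F[X]`-modules. -/
noncomputable def couple {F : Type u} {K : Type v} [Field F] [AddCommGroup K] [Module F K]
    [Module F[X] K] [IsScalarTower F F[X] K] [Module.Free F[X] K] (𝒦 : GradedComplex F K) :
    ExactCouple.{u, v} F where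
  A := Homol 𝒦.d
  E := Homol 𝒦.modX.d
  grA i := homolPart 𝒦.d (𝒦.gr i)
  grE i := homolPart 𝒦.modX.d (𝒦.modX.gr i)
  internalA := homol_internal 𝒦.internal (d_homog _)
  internalE := homol_internal 𝒦.modX.internal (d_homog _)
  f := homolMap (Algebra.lsmul F F K (X : F[X])) fun k => 𝒦.d_smul X k
  g := homolMap (mulRange F K (X : F[X])).mkQ fun _ => rfl
  h := 𝒦.connecting
  homog_f := by
    refine ⟨(0, 1), ?_⟩
    rintro ⟨n, s⟩ _ ⟨⟨k, hk⟩, hm, rfl⟩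
    refine ⟨_, ?_, rfl⟩
    simpa using 𝒦.X_mem n s k hm
  homog_g := by
    refine ⟨0, ?_⟩
    rintro i _ ⟨⟨k, hk⟩, hm, rfl⟩
    rw [add_zero]
    exact ⟨_, ⟨k, hm, rfl⟩, rfl⟩
  homog_h := by
    refine ⟨(-1, -1), ?_⟩
    rintro ⟨n, s⟩ _ ⟨⟨_, hy⟩, ⟨k, hk, rfl⟩, rfl⟩
    have hk' : k ∈ 𝒦.preCyc := (Submodule.Quotient.mk_eq_zero (mulRange F K (X : F[X]))).1 hy
    change 𝒦.connecting (𝒦.preCycClass ⟨k, hk'⟩) ∈ _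
    rw [𝒦.connecting_apply]
    refine ⟨_, ?_, rfl⟩
    change 𝒦.divX ⟨k, hk'⟩ ∈ 𝒦.gr (n - 1, s - 1)
    have hX := 𝒦.X_smul_divX ⟨k, hk'⟩
    have hd : 𝒦.d k ∈ 𝒦.gr (n - 1, s) := 𝒦.d_mem n s k hk
    -- all components of `X⁻¹ d k` outside degree `(n - 1, s - 1)` vanish
    obtain ⟨t, c, hc, hs⟩ := exists_sum 𝒦.internal (𝒦.divX ⟨k, hk'⟩)
    rw [hs]
    refine Submodule.sum_mem _ fun i hi => ?_
    by_cases hin : i = (n - 1, s - 1)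
    · rw [← hin]; exact hc i
    · obtain ⟨π, h1, h2⟩ := exists_proj 𝒦.internal {(i.1, i.2 + 1)}
      have hne : ∀ j : ℤ × ℤ, j ≠ i → (j.1, j.2 + 1) ≠ (i.1, i.2 + 1) := by
        intro j hj h
        apply hj
        simp only [Prod.mk.injEq, add_left_inj] at h
        exact Prod.ext h.1 h.2
      have h0 : π (𝒦.d k) = 0 := by
        refine h2 (n - 1, s) (fun h => hin ?_) _ hd
        have h' : (n - 1, s) = (i.1, i.2 + 1) := h
        simp only [Prod.mk.injEq] at h'
        exact Prod.ext h'.1.symm (by simp only; omega)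
      rw [← hX, hs, Finset.smul_sum, map_sum, Finset.sum_eq_single i] at h0
      · rw [h1 (i.1, i.2 + 1) rfl _ (𝒦.X_mem _ _ _ (hc i))] at h0
        have : c i = 0 := X_cancel (F := F) (by rw [h0, smul_zero])
        rw [this]; exact Submodule.zero_mem _
      · intro j _ hj
        exact h2 _ (hne j hj) _ (𝒦.X_mem _ _ _ (hc j))
      · exact fun h => absurd hi h
  exact_fg := by
    intro q
    obtain ⟨⟨z, hz⟩, rfl⟩ := Submodule.mkQ_surjective _ q
    have hz' : 𝒦.d z = 0 := hz
    have hzp : z ∈ 𝒦.preCyc := by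
      change 𝒦.d z ∈ mulRange F K (X : F[X])
      rw [hz']; exact Submodule.zero_mem _
    change 𝒦.preCycClass ⟨z, hzp⟩ = 0 ↔ _
    rw [𝒦.preCycClass_eq_zero]
    constructor
    · rintro ⟨l, m, h⟩
      have hm : 𝒦.d m = 0 := X_cancel (F := F) (by
        rw [← 𝒦.d_smul, smul_zero, ← hz']
        have h' : z = 𝒦.d l + (X : F[X]) • m := h
        rw [h', map_add, 𝒦.d_d, zero_add])
      refine ⟨Submodule.Quotient.mk ⟨m, hm⟩, (Submodule.Quotient.eq _).2 ⟨-l, ?_⟩⟩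
      change 𝒦.d (-l) = (X : F[X]) • m - z
      have h' : z = 𝒦.d l + (X : F[X]) • m := h
      rw [h', map_neg]; abel
    · rintro ⟨q, hq⟩
      obtain ⟨⟨m, hm⟩, rfl⟩ := Submodule.mkQ_surjective _ q
      obtain ⟨l, hl⟩ := (Submodule.Quotient.eq _).1 hq
      have hl' : 𝒦.d l = (X : F[X]) • m - z := hl
      exact ⟨-l, m, by change z = _; rw [map_neg, hl']; abel⟩
  exact_gh := by
    intro q
    obtain ⟨k, rfl⟩ := 𝒦.preCycClass_surjective q
    rw [𝒦.connecting_apply, 𝒦.divXClass_eq_zero]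
    constructor
    · rintro ⟨m, hm⟩
      have hz : 𝒦.d ((k : K) - (X : F[X]) • m) = 0 := by
        rw [map_sub, 𝒦.d_smul, hm, 𝒦.X_smul_divX, sub_self]
      refine ⟨Submodule.Quotient.mk ⟨_, hz⟩, ?_⟩
      have hzp : (k : K) - (X : F[X]) • m ∈ 𝒦.preCyc := by
        change 𝒦.d _ ∈ mulRange F K (X : F[X])
        rw [hz]; exact Submodule.zero_mem _
      change 𝒦.preCycClass ⟨_, hzp⟩ = 𝒦.preCycClass k
      rw [← sub_eq_zero, ← map_sub, 𝒦.preCycClass_eq_zero]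
      refine ⟨0, -m, ?_⟩
      change (k : K) - (X : F[X]) • m - k = _
      rw [map_zero, smul_neg]; abel
    · rintro ⟨q, hq⟩
      obtain ⟨⟨z, hz⟩, rfl⟩ := Submodule.mkQ_surjective _ q
      have hz' : 𝒦.d z = 0 := hz
      have hzp : z ∈ 𝒦.preCyc := by
        change 𝒦.d z ∈ mulRange F K (X : F[X])
        rw [hz']; exact Submodule.zero_mem _
      have hq' : 𝒦.preCycClass ⟨z, hzp⟩ = 𝒦.preCycClass k := hq
      have := congrArg 𝒦.connecting hq'
      rw [𝒦.connecting_apply, 𝒦.connecting_apply] at this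
      rw [← 𝒦.divXClass_eq_zero, ← this, 𝒦.divXClass_eq_zero]
      refine ⟨0, X_cancel (F := F) ?_⟩
      rw [𝒦.X_smul_divX, map_zero, smul_zero]
      exact hz'.symm
  exact_hf := by
    intro q
    obtain ⟨⟨z, hz⟩, rfl⟩ := Submodule.mkQ_surjective _ q
    have hz' : 𝒦.d z = 0 := hz
    constructor
    · intro h0
      obtain ⟨k, hk⟩ := (Submodule.Quotient.mk_eq_zero _).1 h0
      have hk' : 𝒦.d k = (X : F[X]) • z := hk
      have hkp : k ∈ 𝒦.preCyc := ⟨z, hk'.symm⟩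
      refine ⟨𝒦.preCycClass ⟨k, hkp⟩, ?_⟩
      rw [𝒦.connecting_apply]
      have hdiv : 𝒦.divX ⟨k, hkp⟩ = z := X_cancel (F := F) (by rw [𝒦.X_smul_divX]; exact hk')
      exact congrArg (Submodule.mkQ _) (Subtype.ext hdiv)
    · rintro ⟨q, hq⟩
      obtain ⟨k, rfl⟩ := 𝒦.preCycClass_surjective q
      rw [← hq, 𝒦.connecting_apply]
      exact (Submodule.Quotient.mk_eq_zero _).2 ⟨(k : K), (𝒦.X_smul_divX k).symm⟩

end GradedComplex

namespace FilteredComplex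

/-- On each `Cₙ` the filtration is bounded below. -/
def BoundedBelow {F C : Type*} [Field F] [AddCommGroup C] [Module F C]
    (𝒞 : FilteredComplex F C) : Prop :=
  ∀ n, ∃ p, 𝒞.fil p n = ⊥

/-- Every `𝓕ᵖCₙ` is finite dimensional. -/
def LocallyFinite {F C : Type*} [Field F] [AddCommGroup C] [Module F C]
    (𝒞 : FilteredComplex F C) : Prop :=
  ∀ p n, FiniteDimensional F (𝒞.fil p n)

/-- The direct sum `⨁ₚ 𝓕ᵖC = ⨁_{(n, p)} 𝓕ᵖCₙ` as a vector space. -/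
abbrev Sum {F C : Type*} [Field F] [AddCommGroup C] [Module F C] (𝒞 : FilteredComplex F C) :=
  ⨁ i : ℤ × ℤ, ↥(𝒞.fil i.2 i.1)

theorem sum_internal {F C : Type*} [Field F] [AddCommGroup C] [Module F C]
    (𝒞 : FilteredComplex F C) : DirectSum.IsInternal (fun i =>
      LinearMap.range (DirectSum.lof F (ℤ × ℤ) (fun i => ↥(𝒞.fil i.2 i.1)) i)) :=
  internal_directSum (F := F) (fun i : ℤ × ℤ => ↥(𝒞.fil i.2 i.1))

/-- The sum of the inclusions `𝓕ᵖCₙ → 𝓕ᵖ⁺¹Cₙ`. -/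
noncomputable def shift {F C : Type*} [Field F] [AddCommGroup C] [Module F C]
    (𝒞 : FilteredComplex F C) : 𝒞.Sum →ₗ[F] 𝒞.Sum :=
  DirectSum.toModule F (ℤ × ℤ) _ fun i =>
    DirectSum.lof F (ℤ × ℤ) (fun i => ↥(𝒞.fil i.2 i.1)) (i.1, i.2 + 1) ∘ₗ
      Submodule.inclusion (𝒞.fil_mono i.1 (Int.le_add_one le_rfl))

/-- The sum of the restrictions `𝓕ᵖCₙ → 𝓕ᵖCₙ₋₁` of the differential. -/
noncomputable def dSum {F C : Type*} [Field F] [AddCommGroup C] [Module F C]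
    (𝒞 : FilteredComplex F C) : 𝒞.Sum →ₗ[F] 𝒞.Sum :=
  DirectSum.toModule F (ℤ × ℤ) _ fun i =>
    DirectSum.lof F (ℤ × ℤ) (fun i => ↥(𝒞.fil i.2 i.1)) (i.1 - 1, i.2) ∘ₗ
      𝒞.d.restrict (𝒞.d_fil i.2 i.1)

theorem shift_lof {F C : Type*} [Field F] [AddCommGroup C] [Module F C]
    (𝒞 : FilteredComplex F C) (i : ℤ × ℤ) (v : 𝒞.fil i.2 i.1) :
    𝒞.shift (DirectSum.lof F (ℤ × ℤ) (fun i => ↥(𝒞.fil i.2 i.1)) i v) =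
      DirectSum.lof F (ℤ × ℤ) (fun i => ↥(𝒞.fil i.2 i.1)) (i.1, i.2 + 1)
        (Submodule.inclusion (𝒞.fil_mono i.1 (Int.le_add_one le_rfl)) v) :=
  DirectSum.toModule_lof _ _ _

theorem dSum_lof {F C : Type*} [Field F] [AddCommGroup C] [Module F C]
    (𝒞 : FilteredComplex F C) (i : ℤ × ℤ) (v : 𝒞.fil i.2 i.1) :
    𝒞.dSum (DirectSum.lof F (ℤ × ℤ) (fun i => ↥(𝒞.fil i.2 i.1)) i v) =
      DirectSum.lof F (ℤ × ℤ) (fun i => ↥(𝒞.fil i.2 i.1)) (i.1 - 1, i.2)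
        (𝒞.d.restrict (𝒞.d_fil i.2 i.1) v) :=
  DirectSum.toModule_lof _ _ _

theorem dSum_shift {F C : Type*} [Field F] [AddCommGroup C] [Module F C]
    (𝒞 : FilteredComplex F C) : 𝒞.dSum ∘ₗ 𝒞.shift = 𝒞.shift ∘ₗ 𝒞.dSum := by
  refine DirectSum.linearMap_ext F fun i => LinearMap.ext fun v => ?_
  simp only [LinearMap.comp_apply, shift_lof, dSum_lof]
  exact (𝒞.dSum_lof (i.1, i.2 + 1) _).trans
    (𝒞.shift_lof (i.1 - 1, i.2) (𝒞.d.restrict (𝒞.d_fil i.2 i.1) v)).symm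

theorem dSum_aeval {F C : Type*} [Field F] [AddCommGroup C] [Module F C]
    (𝒞 : FilteredComplex F C) (p : F[X]) : Commute 𝒞.dSum (aeval 𝒞.shift p) := by
  have hc : Commute 𝒞.dSum 𝒞.shift := 𝒞.dSum_shift
  induction p using Polynomial.induction_on' with
  | add p q hp hq => rw [map_add]; exact hp.add_right hq
  | monomial n a =>
    rw [aeval_monomial]
    have ha : Commute 𝒞.dSum (algebraMap F (Module.End F 𝒞.Sum) a) :=
      (Algebra.commutes a 𝒞.dSum).symm
    exact ha.mul_right (hc.pow_right n)

theorem dSum_dSum {F C : Type*} [Field F] [AddCommGroup C] [Module F C]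
    (𝒞 : FilteredComplex F C) : 𝒞.dSum ∘ₗ 𝒞.dSum = 0 := by
  refine DirectSum.linearMap_ext F fun i => LinearMap.ext fun v => ?_
  simp only [LinearMap.comp_apply, dSum_lof, LinearMap.zero_apply]
  refine (𝒞.dSum_lof (i.1 - 1, i.2) _).trans ?_
  have h0 : 𝒞.d.restrict (𝒞.d_fil i.2 (i.1 - 1)) (𝒞.d.restrict (𝒞.d_fil i.2 i.1) v) = 0 :=
    Subtype.ext (𝒞.d_d v)
  rw [h0, map_zero]

/-- The persistent chain complex of `C`, as an `F[X]`-module: `⨁ₚ 𝓕ᵖC` on which `X` acts by the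
inclusions `𝓕ᵖC → 𝓕ᵖ⁺¹C`. -/
def Pers {F C : Type*} [Field F] [AddCommGroup C] [Module F C] (𝒞 : FilteredComplex F C) :=
  𝒞.Sum

instance {F C : Type*} [Field F] [AddCommGroup C] [Module F C] (𝒞 : FilteredComplex F C) :
    AddCommGroup 𝒞.Pers :=
  inferInstanceAs (AddCommGroup 𝒞.Sum)

instance {F C : Type*} [Field F] [AddCommGroup C] [Module F C] (𝒞 : FilteredComplex F C) :
    Module F 𝒞.Pers :=
  inferInstanceAs (Module F 𝒞.Sum)

noncomputable instance {F C : Type*} [Field F] [AddCommGroup C] [Module F C]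
    (𝒞 : FilteredComplex F C) : Module F[X] 𝒞.Pers :=
  Module.compHom 𝒞.Sum (aeval 𝒞.shift).toRingHom

/-- The identity, as an isomorphism of vector spaces. -/
def toPers {F C : Type*} [Field F] [AddCommGroup C] [Module F C] (𝒞 : FilteredComplex F C) :
    𝒞.Sum ≃ₗ[F] 𝒞.Pers :=
  LinearEquiv.refl F 𝒞.Sum

theorem smul_toPers {F C : Type*} [Field F] [AddCommGroup C] [Module F C]
    (𝒞 : FilteredComplex F C) (p : F[X]) (v : 𝒞.Sum) :
    p • 𝒞.toPers v = 𝒞.toPers (aeval 𝒞.shift p v) :=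
  rfl

theorem X_smul_toPers {F C : Type*} [Field F] [AddCommGroup C] [Module F C]
    (𝒞 : FilteredComplex F C) (v : 𝒞.Sum) :
    (X : F[X]) • 𝒞.toPers v = 𝒞.toPers (𝒞.shift v) := by
  rw [smul_toPers, aeval_X]

instance {F C : Type*} [Field F] [AddCommGroup C] [Module F C] (𝒞 : FilteredComplex F C) :
    IsScalarTower F F[X] 𝒞.Pers where
  smul_assoc a p v := by
    obtain ⟨v, rfl⟩ := 𝒞.toPers.surjective v
    rw [smul_toPers, smul_toPers, map_smul, LinearMap.smul_apply, map_smul]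

/-- The persistent chain complex, with `𝓕ᵖCₙ` as its component of bidegree `(n, p)`. -/
noncomputable def pers {F C : Type*} [Field F] [AddCommGroup C] [Module F C]
    (𝒞 : FilteredComplex F C) : GradedComplex F 𝒞.Pers where
  gr i := (LinearMap.range (DirectSum.lof F (ℤ × ℤ) (fun i => ↥(𝒞.fil i.2 i.1)) i)).map
    𝒞.toPers.toLinearMap
  internal := internal_equiv 𝒞.toPers 𝒞.sum_internal
  d := 𝒞.toPers.toLinearMap ∘ₗ 𝒞.dSum ∘ₗ 𝒞.toPers.symm.toLinearMap
  d_d v := by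
    simpa using LinearMap.congr_fun 𝒞.dSum_dSum (𝒞.toPers.symm v)
  d_mem n p := by
    rintro _ ⟨_, ⟨v, rfl⟩, rfl⟩
    refine ⟨_, ⟨𝒞.d.restrict (𝒞.d_fil p n) v, rfl⟩, ?_⟩
    exact congrArg 𝒞.toPers (𝒞.dSum_lof (n, p) v).symm
  X_mem n p := by
    rintro _ ⟨_, ⟨v, rfl⟩, rfl⟩
    refine ⟨_, ⟨Submodule.inclusion (𝒞.fil_mono n (Int.le_add_one le_rfl)) v, rfl⟩, ?_⟩
    exact (congrArg 𝒞.toPers (𝒞.shift_lof (n, p) v).symm).trans (𝒞.X_smul_toPers _).symm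
  d_smul p v := by
    exact congrArg 𝒞.toPers (LinearMap.congr_fun (𝒞.dSum_aeval p) (𝒞.toPers.symm v))

/-- The component `𝓕ᵖCₙ / 𝓕ᵖ⁻¹Cₙ` of the associated graded complex, for `i = (n, p)`. -/
abbrev GrPiece {F C : Type*} [Field F] [AddCommGroup C] [Module F C] (𝒞 : FilteredComplex F C)
    (i : ℤ × ℤ) :=
  ↥(𝒞.fil i.2 i.1) ⧸ (𝒞.fil (i.2 - 1) i.1).comap (𝒞.fil i.2 i.1).subtype

/-- The map `𝓕ᵖCₙ / 𝓕ᵖ⁻¹Cₙ → 𝓕ᵖCₙ₋₁ / 𝓕ᵖ⁻¹Cₙ₋₁` induced by the differential. -/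
noncomputable def dPiece {F C : Type*} [Field F] [AddCommGroup C] [Module F C]
    (𝒞 : FilteredComplex F C) (i : ℤ × ℤ) : 𝒞.GrPiece i →ₗ[F] 𝒞.GrPiece (i.1 - 1, i.2) :=
  Submodule.mapQ _ _ (𝒞.d.restrict (𝒞.d_fil i.2 i.1)) fun v hv => 𝒞.d_fil (i.2 - 1) i.1 v hv

/-- The differential of the associated graded complex. -/
noncomputable def dGr {F C : Type*} [Field F] [AddCommGroup C] [Module F C]
    (𝒞 : FilteredComplex F C) : (⨁ i, 𝒞.GrPiece i) →ₗ[F] (⨁ i, 𝒞.GrPiece i) :=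
  DirectSum.toModule F (ℤ × ℤ) _ fun i =>
    DirectSum.lof F (ℤ × ℤ) 𝒞.GrPiece (i.1 - 1, i.2) ∘ₗ 𝒞.dPiece i

theorem dGr_lof {F C : Type*} [Field F] [AddCommGroup C] [Module F C]
    (𝒞 : FilteredComplex F C) (i : ℤ × ℤ) (v : 𝒞.GrPiece i) :
    𝒞.dGr (DirectSum.lof F (ℤ × ℤ) 𝒞.GrPiece i v) =
      DirectSum.lof F (ℤ × ℤ) 𝒞.GrPiece (i.1 - 1, i.2) (𝒞.dPiece i v) :=
  DirectSum.toModule_lof _ _ _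

theorem dGr_dGr {F C : Type*} [Field F] [AddCommGroup C] [Module F C]
    (𝒞 : FilteredComplex F C) : 𝒞.dGr ∘ₗ 𝒞.dGr = 0 := by
  refine DirectSum.linearMap_ext F fun i => LinearMap.ext fun q => ?_
  obtain ⟨v, rfl⟩ := Submodule.mkQ_surjective _ q
  simp only [LinearMap.comp_apply, dGr_lof, LinearMap.zero_apply]
  have h0 : 𝒞.dPiece (i.1 - 1, i.2) (𝒞.dPiece i (Submodule.mkQ _ v)) = 0 := by
    refine (Submodule.Quotient.mk_eq_zero _).2 ?_
    change 𝒞.d (𝒞.d v) ∈ 𝒞.fil (i.2 - 1) (i.1 - 1 - 1)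
    rw [𝒞.d_d]; exact Submodule.zero_mem _
  rw [h0, map_zero]

/-- The associated graded complex `⨁ₚ 𝓕ᵖC / 𝓕ᵖ⁻¹C`. -/
noncomputable def assocGr {F C : Type*} [Field F] [AddCommGroup C] [Module F C]
    (𝒞 : FilteredComplex F C) : BigradedComplex F (⨁ i, 𝒞.GrPiece i) where
  gr i := LinearMap.range (DirectSum.lof F (ℤ × ℤ) 𝒞.GrPiece i)
  internal := internal_directSum _
  d := 𝒞.dGr
  d_d v := LinearMap.congr_fun 𝒞.dGr_dGr v
  d_mem n p := by
    rintro _ ⟨v, rfl⟩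
    exact ⟨𝒞.dPiece (n, p) v, (𝒞.dGr_lof (n, p) v).symm⟩

end FilteredComplex

end PersistentSS

/-! Write `A` for `H(K)` and `f` for multiplication by `x` on it, and let `T` be the `f`-power
torsion of `A`. The proof expresses both sides of the limit isomorphism through `A` and `f`.

Unwinding the derived couples, page `k + 1` is `Z_k / B_k`, where `Z_k` consists of the `e` with `h
e` in the image of `f ^ k`, and `B_k` is `g (ker f ^ k)` (`mem_cyc`, `mem_bdy`,
`exists_cyc_to_page`). Inside a finite dimensional bidegree both sequences stabilize, which is local
collapse. Since `A` is bounded below in each homological degree, no nonzero element is an `f ^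
k`-image for all `k`. So `Z_∞ = ker h = im g` and `B_∞ = g T`, and exactness gives `E^(∞) = A / (T +
f A)` (`exists_to_EInf`).

On the other side, `x - 1` is injective on the free module `K`, so the kernel of `H(K) →
H(K/(x-1)K)` is `(f - 1) A`. A class in `𝓕ᵖHₙ` has a representative `c` of bidegree `(n, p)` with `d
c ∈ (x - 1) K`. A nonzero homogeneous element is never a multiple of `x - 1`, so `c` is a cycle of
`K`, and `𝓕ᵖHₙ` is the image of `A_{n,p}` (`map_toHomolModXSubOne`).

It remains to compare `A / (T + f A)` with `A / (f - 1) A`. Composing a graded section of the former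
with the projection to the latter gives the isomorphism: setting `f = 1` kills the torsion and
retains the degree of a generator only as a filtration level (`exists_graded_to_filtered`).

For a filtered complex, the inclusions make `x` injective on `⨁ 𝓕ᵖC`. With the lower bounds this
gives freeness, by lifting a basis of `K/xK` (`free_of_graded`). The two quotients are computed
summand by summand. -/

namespace PersistentSS

universe u v

/-! ### Homogeneous components -/

section Component

variable {F ι M : Type*} [Field F] [DecidableEq ι] [AddCommGroup M] [Module F M]
  {G : ι → Submodule F M}

/-- The projection onto the component of degree `i` of an internally graded space. -/
noncomputable def gradedComponent (hG : DirectSum.IsInternal G) (i : ι) : M →ₗ[F] M :=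
  (exists_proj hG {i}).choose

theorem gradedComponent_of_mem (hG : DirectSum.IsInternal G) {i : ι} {m : M} (hm : m ∈ G i) :
    gradedComponent hG i m = m :=
  (exists_proj hG {i}).choose_spec.1 i rfl m hm

theorem gradedComponent_of_mem_ne (hG : DirectSum.IsInternal G) {i j : ι} (hij : j ≠ i) {m : M}
    (hm : m ∈ G j) : gradedComponent hG i m = 0 :=
  (exists_proj hG {i}).choose_spec.2 j hij m hm

theorem gradedComponent_mem (hG : DirectSum.IsInternal G) (i : ι) (m : M) :
    gradedComponent hG i m ∈ G i := by
  obtain ⟨s, c, hc, rfl⟩ := exists_sum hG m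
  rw [map_sum]
  refine Submodule.sum_mem _ fun j _ => ?_
  by_cases hj : j = i
  · subst hj
    rw [gradedComponent_of_mem hG (hc j)]
    exact hc j
  · rw [gradedComponent_of_mem_ne hG hj (hc j)]
    exact Submodule.zero_mem _

theorem exists_eq_sum_gradedComponent (hG : DirectSum.IsInternal G) (m : M) :
    ∃ s : Finset ι, (∀ i ∉ s, gradedComponent hG i m = 0) ∧
      m = ∑ i ∈ s, gradedComponent hG i m := by
  obtain ⟨s, c, hc, hm⟩ := exists_sum hG m
  have h0 : ∀ i ∉ s, gradedComponent hG i m = 0 := by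
    intro i hi
    rw [hm, map_sum]
    refine Finset.sum_eq_zero fun j hj => gradedComponent_of_mem_ne hG ?_ (hc j)
    rintro rfl
    exact hi hj
  refine ⟨s, h0, ?_⟩
  conv_lhs => rw [hm]
  refine Finset.sum_congr rfl fun i hi => ?_
  rw [hm, map_sum, Finset.sum_eq_single i]
  · exact (gradedComponent_of_mem hG (hc i)).symm
  · exact fun j _ hj => gradedComponent_of_mem_ne hG hj (hc j)
  · exact fun h => absurd hi h

theorem eq_zero_of_gradedComponent (hG : DirectSum.IsInternal G) {m : M}
    (h : ∀ i, gradedComponent hG i m = 0) : m = 0 := by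
  obtain ⟨s, -, hm⟩ := exists_eq_sum_gradedComponent hG m
  rw [hm]
  exact Finset.sum_eq_zero fun i _ => h i

theorem linearMap_eq_of_graded {N : Type*} [AddCommGroup N] [Module F N]
    (hG : DirectSum.IsInternal G) {φ ψ : M →ₗ[F] N} (h : ∀ i, ∀ m ∈ G i, φ m = ψ m) (m : M) :
    φ m = ψ m := by
  obtain ⟨s, c, hc, rfl⟩ := exists_sum hG m
  rw [map_sum, map_sum]
  exact Finset.sum_congr rfl fun i _ => h i _ (hc i)

/-- Injectivity of `τ` keeps the other components of `m` from landing in degree `τ i`. -/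
theorem gradedComponent_map {κ N : Type*} [DecidableEq κ] [AddCommGroup N] [Module F N]
    {G' : κ → Submodule F N} (hG : DirectSum.IsInternal G) (hG' : DirectSum.IsInternal G')
    {τ : ι → κ} (hτ : Function.Injective τ) {φ : M →ₗ[F] N} (hφ : ∀ i, ∀ m ∈ G i, φ m ∈ G' (τ i))
    (i : ι) (m : M) : gradedComponent hG' (τ i) (φ m) = φ (gradedComponent hG i m) := by
  refine linearMap_eq_of_graded hG (φ := gradedComponent hG' (τ i) ∘ₗ φ)
    (ψ := φ ∘ₗ gradedComponent hG i) (fun j v hv => ?_) m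
  change gradedComponent hG' (τ i) (φ v) = φ (gradedComponent hG i v)
  by_cases hj : j = i
  · subst hj
    rw [gradedComponent_of_mem hG hv, gradedComponent_of_mem hG' (hφ _ _ hv)]
  · rw [gradedComponent_of_mem_ne hG hj hv, map_zero,
      gradedComponent_of_mem_ne hG' (hτ.ne hj) (hφ _ _ hv)]

/-- A graded map that is injective on the homogeneous components is injective. -/
theorem injective_of_graded {κ N : Type*} [DecidableEq κ] [AddCommGroup N] [Module F N]
    {G' : κ → Submodule F N} (hG : DirectSum.IsInternal G) (hG' : DirectSum.IsInternal G')
    {τ : ι → κ} (hτ : Function.Injective τ) {φ : M →ₗ[F] N} (hφ : ∀ i, ∀ m ∈ G i, φ m ∈ G' (τ i))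
    (h0 : ∀ i, ∀ m ∈ G i, φ m = 0 → m = 0) : Function.Injective φ := by
  rw [injective_iff_map_eq_zero]
  intro m hm
  refine eq_zero_of_gradedComponent hG fun i => h0 i _ (gradedComponent_mem hG i m) ?_
  rw [← gradedComponent_map hG hG' hτ hφ, hm, map_zero]

theorem surjective_of_graded {N : Type*} [AddCommGroup N] [Module F N]
    {G' : ι → Submodule F N} (hG' : DirectSum.IsInternal G') {φ : M →ₗ[F] N}
    (hφ : ∀ i, G' i ≤ (G i).map φ) : Function.Surjective φ := by
  rw [← LinearMap.range_eq_top, eq_top_iff, ← hG'.submodule_iSup_eq_top]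
  exact iSup_le fun i => (hφ i).trans LinearMap.map_le_range

/-- A surjection from a graded space with graded kernel induces a grading on the target. -/
theorem internal_map {N : Type*} [AddCommGroup N] [Module F N] (hG : DirectSum.IsInternal G)
    {γ : M →ₗ[F] N} (hγ : Function.Surjective γ)
    (hker : ∀ m, γ m = 0 → ∀ i, γ (gradedComponent hG i m) = 0) :
    DirectSum.IsInternal fun i => (G i).map γ := by
  have hN : LinearMap.ker γ ≤ ⨆ i, G i ⊓ LinearMap.ker γ := by
    intro m hm
    obtain ⟨s, -, hs⟩ := exists_eq_sum_gradedComponent hG m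
    rw [hs]
    exact Submodule.sum_mem _ fun i _ => Submodule.mem_iSup_of_mem i
      ⟨gradedComponent_mem hG i m, hker m hm i⟩
  have h := internal_equiv (γ.quotKerEquivOfSurjective hγ) (internal_quot hG hN)
  have he : (γ.quotKerEquivOfSurjective hγ).toLinearMap ∘ₗ (LinearMap.ker γ).mkQ = γ := rfl
  simpa only [← Submodule.map_comp, he] using h

/-- A surjection of graded spaces has a graded section. -/
theorem exists_graded_section {N : Type*} [AddCommGroup N] [Module F N] {γ : M →ₗ[F] N}
    (hG' : DirectSum.IsInternal fun i => (G i).map γ) :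
    ∃ σ : N →ₗ[F] M, (∀ q, γ (σ q) = q) ∧ ∀ i, ∀ q ∈ (G i).map γ, σ q ∈ G i := by
  -- Over a field each component has its own linear section; the grading of the target glues them.
  have hs : ∀ i, ∃ s : ↥((G i).map γ) →ₗ[F] ↥(G i), ∀ q, γ (s q) = q := by
    intro i
    obtain ⟨s, hs⟩ := (γ.restrict (p := G i) (q := (G i).map γ) fun m hm =>
      Submodule.mem_map_of_mem hm).exists_rightInverse_of_surjective (by
        rw [LinearMap.range_eq_top]
        rintro ⟨_, m, hm, rfl⟩
        exact ⟨⟨m, hm⟩, rfl⟩)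
    exact ⟨s, fun q => congrArg Subtype.val (LinearMap.congr_fun hs q)⟩
  choose s hs using hs
  let e := LinearEquiv.ofBijective (DirectSum.coeLinearMap fun i => (G i).map γ) hG'
  let σ : N →ₗ[F] M :=
    DirectSum.toModule F ι M (fun i => (G i).subtype ∘ₗ s i) ∘ₗ e.symm.toLinearMap
  have key : ∀ i, ∀ q (hq : q ∈ (G i).map γ), σ q = s i ⟨q, hq⟩ := by
    intro i q hq
    have : e.symm q = DirectSum.lof F ι (fun i => (G i).map γ) i ⟨q, hq⟩ := by
      rw [LinearEquiv.symm_apply_eq]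
      exact (DirectSum.coeLinearMap_lof (fun i => (G i).map γ) i ⟨q, hq⟩).symm
    change DirectSum.toModule F ι M (fun i => (G i).subtype ∘ₗ s i) (e.symm q) = _
    rw [this, DirectSum.toModule_lof]
    rfl
  refine ⟨σ, fun q => ?_, fun i q hq => ?_⟩
  · refine linearMap_eq_of_graded hG' (φ := γ ∘ₗ σ) (ψ := LinearMap.id) (fun i v hv => ?_) q
    change γ (σ v) = v
    rw [key i v hv, hs]
  · rw [key i q hq]
    exact (s i _).2

end Component

/-! ### Graded modules with an operator of degree `(0, 1)` -/

section Shift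

variable {F A : Type*} [Field F] [AddCommGroup A] [Module F A] {G : ℤ × ℤ → Submodule F A}

theorem up_injective : Function.Injective fun i : ℤ × ℤ => (i.1, i.2 + 1) := by
  rintro ⟨a, b⟩ ⟨c, d⟩ h
  simpa using h

theorem gradedComponent_shift (hG : DirectSum.IsInternal G) {f : A →ₗ[F] A}
    (hf : ∀ n s, ∀ a ∈ G (n, s), f a ∈ G (n, s + 1)) (n s : ℤ) (a : A) :
    gradedComponent hG (n, s + 1) (f a) = f (gradedComponent hG (n, s) a) :=
  gradedComponent_map hG hG up_injective (fun i a ha => hf i.1 i.2 a ha) (n, s) a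

theorem gradedComponent_shift_pow (hG : DirectSum.IsInternal G) {f : A →ₗ[F] A}
    (hf : ∀ n s, ∀ a ∈ G (n, s), f a ∈ G (n, s + 1)) (n s : ℤ) (k : ℕ) (a : A) :
    gradedComponent hG (n, s + k) ((f ^ k) a) = (f ^ k) (gradedComponent hG (n, s) a) := by
  induction k with
  | zero => simp
  | succ k ih =>
    rw [pow_succ', Module.End.mul_apply, Module.End.mul_apply, ← ih,
      ← gradedComponent_shift hG hf, Nat.cast_succ, add_assoc]

theorem shift_pow_mem {f : A →ₗ[F] A} (hf : ∀ n s, ∀ a ∈ G (n, s), f a ∈ G (n, s + 1)) (n s : ℤ)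
    (k : ℕ) {a : A} (ha : a ∈ G (n, s)) : (f ^ k) a ∈ G (n, s + k) := by
  induction k with
  | zero => simpa using ha
  | succ k ih =>
    rw [pow_succ', Module.End.mul_apply, Nat.cast_succ, ← add_assoc]
    exact hf _ _ _ ih

theorem exists_gradedComponent_eq_zero_of_ge (hG : DirectSum.IsInternal G) (a : A) :
    ∃ N : ℤ, ∀ n s, (N ≤ s ∨ s ≤ -N) → gradedComponent hG (n, s) a = 0 := by
  obtain ⟨S, hS, -⟩ := exists_eq_sum_gradedComponent hG a
  -- A crude bound: each `|i.2|` with `i ∈ S` is at most the whole sum, and the `+ 1` makes the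
  -- inequality strict.
  refine ⟨∑ i ∈ S, |i.2| + 1, fun n s hs => hS _ fun hmem => ?_⟩
  have := Finset.single_le_sum (f := fun i : ℤ × ℤ => |i.2|) (fun i _ => abs_nonneg _) hmem
  have h2 : |s| ≤ ∑ i ∈ S, |i.2| := this
  rcases hs with hs | hs
  · linarith [le_abs_self s]
  · linarith [neg_abs_le s]

/-- If `f` is injective, then a preimage under `f - 1` of a homogeneous element is zero. -/
theorem eq_zero_of_sub_one_homogeneous (hG : DirectSum.IsInternal G) {f : A →ₗ[F] A}
    (hf : ∀ n s, ∀ a ∈ G (n, s), f a ∈ G (n, s + 1)) (hinj : Function.Injective f) {n p : ℤ}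
    {m : A} (hm : f m - m ∈ G (n, p)) : m = 0 := by
  -- The component of `f m - m` in degree `s + 1` is `f m_s - m_{s+1}`, which vanishes outside `(n,
  -- p)`.
  have step : ∀ n' s, (n', s + 1) ≠ (n, p) →
      f (gradedComponent hG (n', s) m) = gradedComponent hG (n', s + 1) m := by
    intro n' s hne
    have h := gradedComponent_of_mem_ne hG hne.symm hm
    rwa [map_sub, gradedComponent_shift hG hf, sub_eq_zero] at h
  obtain ⟨N, hN⟩ := exists_gradedComponent_eq_zero_of_ge hG m
  -- Below degree `p`, vanishing propagates upward from degree `-N` by `m_{s+1} = f m_s`.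
  have low : ∀ n' (k : ℕ), -N + k < p → gradedComponent hG (n', -N + k) m = 0 := by
    intro n' k
    induction k with
    | zero => exact fun _ => hN _ _ (Or.inr (by simp))
    | succ k ih =>
      intro hk
      push_cast at hk ⊢
      rw [← add_assoc, ← step, ih (by linarith), map_zero]
      intro h
      have := congrArg Prod.snd h
      simp only at this
      omega
  -- From degree `p` on, vanishing propagates downward from `N`: `f m_s = m_{s+1} = 0` and `f` is
  -- injective.
  have high : ∀ n' (k : ℕ), p ≤ N - k → gradedComponent hG (n', N - k) m = 0 := by
    intro n' k
    induction k with
    | zero => exact fun _ => hN _ _ (Or.inl (by simp))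
    | succ k ih =>
      intro hk
      push_cast at hk ⊢
      apply hinj
      rw [step, map_zero, show N - ((k : ℤ) + 1) + 1 = N - k by ring, ih (by linarith)]
      intro h
      have := congrArg Prod.snd h
      simp only at this
      omega
  refine eq_zero_of_gradedComponent hG ?_
  rintro ⟨n', s⟩
  rcases lt_or_ge s p with hs | hs
  · rcases le_or_gt s (-N) with h | h
    · exact hN _ _ (Or.inr h)
    · have := low n' (s + N).toNat
      rw [Int.toNat_of_nonneg (by linarith), show -N + (s + N) = s by ring] at this
      exact this hs
  · rcases le_or_gt N s with h | h
    · exact hN _ _ (Or.inl h)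
    · have := high n' (N - s).toNat
      rw [Int.toNat_of_nonneg (by linarith), show N - (N - s) = s by ring] at this
      exact this hs

/-- Let `f` have degree `(0, 1)` on the bigraded space `A`, which is bounded below in each row, and
let `T` be the `f`-power torsion. Then `A / (T + f A)` and `A / (f - 1) A` are related by an
injection that matches the grading with the filtration. -/
theorem exists_graded_to_filtered {Q L : Type*} [AddCommGroup Q] [Module F Q] [AddCommGroup L]
    [Module F L] (hG : DirectSum.IsInternal G) {f : A →ₗ[F] A}
    (hf : ∀ n s, ∀ a ∈ G (n, s), f a ∈ G (n, s + 1)) (hb : ∀ n, ∃ b : ℤ, ∀ s < b, G (n, s) = ⊥)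
    {γ : A →ₗ[F] Q} (hγ : Function.Surjective γ)
    (hγker : ∀ a, γ a = 0 ↔ ∃ (k : ℕ) (t b : A), (f ^ k) t = 0 ∧ a = t + f b)
    {ι : A →ₗ[F] L} (hι : ∀ a, ι a = 0 ↔ ∃ b, a = f b - b) :
    ∃ e : Q →ₗ[F] L, Function.Injective e ∧ ∀ p n,
      (⨆ s, ⨆ _ : s ≤ p, (G (n, s)).map γ).map e = (G (n, p)).map ι := by
  -- `T + f A` is a graded subspace: components of torsion are killed by the same power of `f`, and
  -- `(f b)_s = f b_{s-1}`.
  have hker : ∀ a, γ a = 0 → ∀ i, γ (gradedComponent hG i a) = 0 := by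
    rintro a ha ⟨n, s⟩
    obtain ⟨k, t, b, ht, rfl⟩ := (hγker a).1 ha
    refine (hγker _).2 ⟨k, gradedComponent hG (n, s) t, gradedComponent hG (n, s - 1) b, ?_, ?_⟩
    · rw [← gradedComponent_shift_pow hG hf, ht, map_zero]
    · rw [← gradedComponent_shift hG hf, sub_add_cancel, map_add]
  have hQ := internal_map hG hγ hker
  obtain ⟨σ, hσ, hσG⟩ := exists_graded_section hQ
  have hιf : ∀ a, ι (f a) = ι a := fun a => by
    rw [← sub_eq_zero, ← map_sub]
    exact (hι _).2 ⟨a, rfl⟩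
  have hιpow : ∀ (k : ℕ) a, ι ((f ^ k) a) = ι a := by
    intro k a
    induction k with
    | zero => simp
    | succ k ih => rw [pow_succ', Module.End.mul_apply, hιf, ih]
  refine ⟨ι ∘ₗ σ, ?_, fun p n => le_antisymm ?_ ?_⟩
  · rw [injective_iff_map_eq_zero]
    intro q hq
    obtain ⟨b, hb'⟩ := (hι _).1 hq
    -- Here `σ q = f b - b`; this is its component in degree `s + 1`.
    have hcomp : ∀ n s, σ (gradedComponent hQ (n, s + 1) q) =
        f (gradedComponent hG (n, s) b) - gradedComponent hG (n, s + 1) b := by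
      intro n s
      rw [← gradedComponent_map hQ hG Function.injective_id hσG, hb', id, map_sub,
        gradedComponent_shift hG hf]
    -- If `b_{s+1}` is torsion, then `f b_s - b_{s+1}` lies in `T + f A`, which `γ` kills.
    have main : ∀ n s, (∃ k : ℕ, (f ^ k) (gradedComponent hG (n, s + 1) b) = 0) →
        gradedComponent hQ (n, s + 1) q = 0 := by
      rintro n s ⟨k, hk⟩
      rw [← hσ (gradedComponent hQ (n, s + 1) q), hcomp]
      exact (hγker _).2 ⟨k, -gradedComponent hG (n, s + 1) b, gradedComponent hG (n, s) b,
        by rw [map_neg, hk, neg_zero], by abel⟩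
    obtain ⟨N, hN⟩ := exists_gradedComponent_eq_zero_of_ge hG b
    -- Descending induction from the degree `N` where `b` vanishes: once `b_{s+1}` is torsion,
    -- `q_{s+1} = 0`, so `f b_s = b_{s+1}` and `b_s` is torsion too.
    have tors : ∀ n (k : ℕ), ∃ l : ℕ, (f ^ l) (gradedComponent hG (n, N - k) b) = 0 := by
      intro n k
      induction k with
      | zero => exact ⟨0, by simpa using hN n N (Or.inl le_rfl)⟩
      | succ k ih =>
        have hk : N - ((k + 1 : ℕ) : ℤ) + 1 = N - k := by push_cast; ring
        rw [← hk] at ih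
        have h1 := hcomp n (N - ((k + 1 : ℕ) : ℤ))
        rw [main _ _ ih, map_zero, eq_comm, sub_eq_zero] at h1
        obtain ⟨l, hl⟩ := ih
        exact ⟨l + 1, by rw [pow_succ, Module.End.mul_apply, h1, hl]⟩
    refine eq_zero_of_gradedComponent hQ ?_
    rintro ⟨n, s⟩
    have := main n (s - 1)
    rw [sub_add_cancel] at this
    apply this
    rcases le_or_gt N s with h | h
    · exact ⟨0, by simpa using hN n s (Or.inl h)⟩
    · have h2 := tors n (N - s).toNat
      rwa [Int.toNat_of_nonneg (by linarith), show N - (N - s) = s by ring] at h2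
  · rw [Submodule.map_le_iff_le_comap]
    refine iSup₂_le fun s hs q hq => ?_
    -- `ι` does not see powers of `f`, so an element of degree `s ≤ p` may be pushed up to degree
    -- `p`.
    refine ⟨(f ^ (p - s).toNat) (σ q), ?_, hιpow _ _⟩
    have := shift_pow_mem hf n s (p - s).toNat (hσG _ q hq)
    rwa [Int.toNat_of_nonneg (by linarith), show s + (p - s) = p by ring] at this
  · obtain ⟨c, hc⟩ := hb n
    -- Induction on the degree, starting at `c - 1`, where the component is zero. Modulo the lift `σ
    -- (γ a)`, an element `a` is torsion plus `f b`, and under `ι` the remainder becomes the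
    -- component of `b` one degree lower.
    have main : ∀ k : ℕ, (G (n, c - 1 + k)).map ι ≤
        (⨆ s, ⨆ _ : s ≤ c - 1 + k, (G (n, s)).map γ).map (ι ∘ₗ σ) := by
      intro k
      induction k with
      | zero => rw [hc _ (by simp), Submodule.map_bot]; exact bot_le
      | succ k ih =>
        rintro _ ⟨a, ha, rfl⟩
        have h0 : γ (a - σ (γ a)) = 0 := by rw [map_sub, hσ, sub_self]
        have hγa : γ a ∈ (G (n, c - 1 + (k + 1 : ℕ))).map γ := Submodule.mem_map_of_mem ha
        have hmem := Submodule.sub_mem _ ha (hσG _ _ hγa)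
        obtain ⟨l, t, b, ht, hab⟩ := (hγker _).1 h0
        -- The torsion term drops out because `ι t = ι (f ^ l t)`, applied to the relevant component
        -- of `t`.
        have h1 : ι (a - σ (γ a)) = ι (gradedComponent hG (n, c - 1 + k) b) := by
          rw [← gradedComponent_of_mem hG hmem, hab, map_add, map_add, ← hιpow l,
            ← gradedComponent_shift_pow hG hf, ht, map_zero, map_zero, zero_add,
            Nat.cast_succ, ← add_assoc, gradedComponent_shift hG hf, hιf]
        have h2 : ι a = (ι ∘ₗ σ) (γ a) + ι (gradedComponent hG (n, c - 1 + k) b) := by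
          rw [← h1, map_sub]; simp
        rw [h2]
        refine Submodule.add_mem _ (Submodule.mem_map_of_mem ?_) ?_
        · exact Submodule.mem_iSup_of_mem _ (Submodule.mem_iSup_of_mem le_rfl hγa)
        · refine Submodule.map_mono (iSup_mono fun s => ?_)
            (ih (Submodule.mem_map_of_mem (gradedComponent_mem hG _ b)))
          refine iSup_mono' fun hs => ⟨hs.trans (by push_cast; linarith), le_rfl⟩
    rcases lt_or_ge p c with hp | hp
    · rw [hc p hp, Submodule.map_bot]; exact bot_le
    · have := main (p - (c - 1)).toNat
      rwa [Int.toNat_of_nonneg (by linarith), show c - 1 + (p - (c - 1)) = p by ring] at this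

end Shift

/-! ### Pages of the spectral sequence as subquotients of `E` -/

namespace ExactCouple

variable {F : Type u} [Field F]

/-- The inclusion of `A' = f(A)` in `A`. -/
noncomputable def derivedIncl (C : ExactCouple.{u, v} F) : C.derived.A →ₗ[F] C.A :=
  (LinearMap.range C.f).subtype

theorem derivedIncl_f_pow (C : ExactCouple.{u, v} F) (k : ℕ) (a : C.derived.A) :
    C.derivedIncl ((C.derived.f ^ k) a) = (C.f ^ k) (C.derivedIncl a) := by
  induction k with
  | zero => rfl
  | succ k ih =>
    rw [pow_succ', pow_succ', Module.End.mul_apply, Module.End.mul_apply, ← ih]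
    rfl

theorem mem_cyc_succ (C : ExactCouple.{u, v} F) (k : ℕ) (e : C.E) :
    e ∈ cyc (k + 1) C ↔ ∃ he : e ∈ LinearMap.ker C.d, C.toDerived ⟨e, he⟩ ∈ cyc k C.derived := by
  constructor
  · rintro ⟨⟨e, he⟩, h, rfl⟩
    exact ⟨he, h⟩
  · rintro ⟨he, h⟩
    exact ⟨⟨e, he⟩, h, rfl⟩

theorem mem_bdy_succ (C : ExactCouple.{u, v} F) (k : ℕ) (e : C.E) :
    e ∈ bdy (k + 1) C ↔ ∃ he : e ∈ LinearMap.ker C.d, C.toDerived ⟨e, he⟩ ∈ bdy k C.derived := by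
  constructor
  · rintro ⟨⟨e, he⟩, h, rfl⟩
    exact ⟨he, h⟩
  · rintro ⟨he, h⟩
    exact ⟨⟨e, he⟩, h, rfl⟩

theorem cyc_succ_le_ker (C : ExactCouple.{u, v} F) (k : ℕ) : cyc (k + 1) C ≤ LinearMap.ker C.d :=
  fun _ he => ((C.mem_cyc_succ k _).1 he).1

/-- An element survives `k` times if and only if `h` sends it to a `k`-fold image of `f`. -/
theorem mem_cyc (k : ℕ) (C : ExactCouple.{u, v} F) (e : C.E) :
    e ∈ cyc k C ↔ ∃ a, (C.f ^ k) a = C.h e := by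
  induction k generalizing C with
  | zero => exact ⟨fun _ => ⟨C.h e, rfl⟩, fun _ => trivial⟩
  | succ k ih =>
    rw [mem_cyc_succ]
    constructor
    · rintro ⟨he, h⟩
      -- Elements of `A'` have the form `f b`, so a `k`-fold image in `A'` is a `(k + 1)`-fold image
      -- in `A`.
      obtain ⟨⟨_, b, rfl⟩, hb⟩ := (ih _ _).1 h
      refine ⟨b, ?_⟩
      rw [pow_succ, Module.End.mul_apply]
      have h1 := congrArg C.derivedIncl hb
      exact (C.derivedIncl_f_pow k _).symm.trans h1
    · rintro ⟨b, hb⟩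
      have he : e ∈ LinearMap.ker C.d := (C.exact_fg _).2 ⟨(C.f ^ k) b, by
        rw [← hb, pow_succ', Module.End.mul_apply]⟩
      refine ⟨he, (ih _ _).2 ⟨⟨C.f b, b, rfl⟩, Subtype.ext ?_⟩⟩
      refine (C.derivedIncl_f_pow k _).trans ?_
      change (C.f ^ k) (C.f b) = C.h e
      rw [← hb, pow_succ, Module.End.mul_apply]

/-- An element becomes zero after `k` steps if and only if it is the image under `g` of an element
that `f ^ k` kills. -/
theorem mem_bdy (k : ℕ) (C : ExactCouple.{u, v} F) (e : C.E) :
    e ∈ bdy k C ↔ ∃ a, (C.f ^ k) a = 0 ∧ C.g a = e := by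
  induction k generalizing C with
  | zero =>
    constructor
    · intro he
      have he' : e = 0 := he
      exact ⟨0, map_zero _, by rw [map_zero, he']⟩
    · rintro ⟨a, ha, rfl⟩
      have ha' : a = 0 := ha
      rw [ha', map_zero]
      exact Submodule.zero_mem _
  | succ k ih =>
    rw [mem_bdy_succ]
    constructor
    · rintro ⟨he, h⟩
      obtain ⟨⟨_, a, rfl⟩, ha, hg⟩ := (ih _ _).1 h
      have h1 : (C.f ^ k) (C.f a) = 0 :=
        (C.derivedIncl_f_pow k _).symm.trans (congrArg C.derivedIncl ha)
      have h2 : C.gClass a = C.toDerived ⟨e, he⟩ := (C.g'_apply a).symm.trans hg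
      obtain ⟨x, hx⟩ := (Submodule.Quotient.eq _).1 h2
      have hx' : C.g (C.h x) = C.g a - e := hx
      -- `g a` agrees with `e` only up to the boundary `g (h x)`; subtracting `h x` corrects this
      -- and does not change `f a`.
      refine ⟨a - C.h x, ?_, by rw [map_sub, hx', sub_sub_cancel]⟩
      rw [pow_succ, Module.End.mul_apply, map_sub, C.f_h, sub_zero, h1]
    · rintro ⟨a, ha, rfl⟩
      have he : C.g a ∈ LinearMap.ker C.d := by simp [d, C.h_g]
      refine ⟨he, (ih _ _).2 ⟨⟨C.f a, a, rfl⟩, Subtype.ext ?_, C.g'_apply a⟩⟩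
      refine (C.derivedIncl_f_pow k _).trans ?_
      change (C.f ^ k) (C.f a) = 0
      rw [← ha, pow_succ, Module.End.mul_apply]

theorem cyc_antitone (C : ExactCouple.{u, v} F) : Antitone fun k => cyc k C := by
  refine antitone_nat_of_succ_le fun k e he => ?_
  obtain ⟨a, ha⟩ := (mem_cyc _ _ _).1 he
  exact (mem_cyc _ _ _).2 ⟨C.f a, by rw [← ha, pow_succ, Module.End.mul_apply]⟩

theorem bdy_monotone (C : ExactCouple.{u, v} F) : Monotone fun k => bdy k C := by
  refine monotone_nat_of_le_succ fun k e he => ?_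
  obtain ⟨a, ha, hg⟩ := (mem_bdy _ _ _).1 he
  exact (mem_bdy _ _ _).2 ⟨a, by rw [pow_succ', Module.End.mul_apply, ha, map_zero], hg⟩

theorem mem_bdyInf (C : ExactCouple.{u, v} F) (e : C.E) : e ∈ C.bdyInf ↔ ∃ k, e ∈ bdy k C :=
  Submodule.mem_iSup_of_directed _ C.bdy_monotone.directed_le

/-- Each page is a quotient of the surviving elements of `E`, as a graded space. -/
theorem exists_cyc_to_page (k : ℕ) (C : ExactCouple.{u, v} F) :
    ∃ φ : ↥(cyc k C) →ₗ[F] (derived^[k] C).E,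
      LinearMap.ker φ = (bdy k C).comap (cyc k C).subtype ∧
      ∀ i, ((C.grE i).comap (cyc k C).subtype).map φ = (derived^[k] C).grE i := by
  induction k generalizing C with
  | zero =>
    change ∃ φ : ↥(cyc 0 C) →ₗ[F] C.E, LinearMap.ker φ = (bdy 0 C).comap (cyc 0 C).subtype ∧
      ∀ i, ((C.grE i).comap (cyc 0 C).subtype).map φ = C.grE i
    refine ⟨(cyc 0 C).subtype, ?_, fun i => ?_⟩
    · rw [Submodule.ker_subtype]
      exact ((Submodule.comap_bot _).trans (Submodule.ker_subtype _)).symm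
    · rw [Submodule.map_comap_subtype]
      exact top_inf_eq _
  | succ k ih =>
    -- The iterate is unfolded at its innermost step, as in the recursions for `cyc` and `bdy`, so
    -- that the induction hypothesis applies to `C.derived`.
    change ∃ φ : ↥(cyc (k + 1) C) →ₗ[F] (derived^[k] C.derived).E,
      LinearMap.ker φ = (bdy (k + 1) C).comap (cyc (k + 1) C).subtype ∧
      ∀ i, ((C.grE i).comap (cyc (k + 1) C).subtype).map φ = (derived^[k] C.derived).grE i
    obtain ⟨φ, hker, hgr⟩ := ih C.derived
    let ψ : ↥(cyc (k + 1) C) →ₗ[F] ↥(cyc k C.derived) :=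
      (C.toDerived ∘ₗ Submodule.inclusion (C.cyc_succ_le_ker k)).codRestrict _
        fun e => ((C.mem_cyc_succ k _).1 e.2).2
    refine ⟨φ ∘ₗ ψ, ?_, fun i => ?_⟩
    · rw [LinearMap.ker_comp, hker]
      ext ⟨e, he⟩
      exact ⟨fun h => (C.mem_bdy_succ k e).2 ⟨C.cyc_succ_le_ker k he, h⟩,
        fun h => ((C.mem_bdy_succ k e).1 h).2⟩
    · rw [Submodule.map_comp]
      refine Eq.trans ?_ (hgr i)
      congr 1
      ext ⟨q, hq⟩
      constructor
      · rintro ⟨e, he, hq⟩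
        rw [← hq]
        exact ⟨Submodule.inclusion (C.cyc_succ_le_ker k) e, he, rfl⟩
      · rintro ⟨⟨e, hed⟩, he, rfl⟩
        exact ⟨⟨e, (C.mem_cyc_succ k e).2 ⟨hed, hq⟩⟩, he, rfl⟩

end ExactCouple

/-! ### Stabilization of subquotients in finite dimension -/

/-- Two subquotients of `W` cut out by the same cycles and boundaries are isomorphic. -/
theorem nonempty_equiv_of_inf_eq {F M P Q : Type*} [Field F] [AddCommGroup M] [Module F M]
    [AddCommGroup P] [Module F P] [AddCommGroup Q] [Module F Q] {W Z B Z' B' : Submodule F M}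
    {φ : Z →ₗ[F] P} {φ' : Z' →ₗ[F] Q} (hφ : LinearMap.ker φ = B.comap Z.subtype)
    (hφ' : LinearMap.ker φ' = B'.comap Z'.subtype) (hZ : W ⊓ Z = W ⊓ Z') (hB : W ⊓ B = W ⊓ B') :
    Nonempty (↥((W.comap Z.subtype).map φ) ≃ₗ[F] ↥((W.comap Z'.subtype).map φ')) := by
  -- Both sides are images of the common space `W ⊓ Z`, under maps whose kernels agree.
  let α := φ ∘ₗ Submodule.inclusion (inf_le_right : W ⊓ Z ≤ Z)
  let β := φ' ∘ₗ Submodule.inclusion (hZ.le.trans inf_le_right : W ⊓ Z ≤ Z')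
  have hα : LinearMap.range α = (W.comap Z.subtype).map φ := by
    ext q
    constructor
    · rintro ⟨⟨m, hW, hm⟩, rfl⟩
      exact ⟨⟨m, hm⟩, hW, rfl⟩
    · rintro ⟨⟨m, hm⟩, hW, rfl⟩
      exact ⟨⟨m, hW, hm⟩, rfl⟩
  have hβ : LinearMap.range β = (W.comap Z'.subtype).map φ' := by
    ext q
    constructor
    · rintro ⟨⟨m, hW, hm⟩, rfl⟩
      exact ⟨⟨m, (hZ.le ⟨hW, hm⟩).2⟩, hW, rfl⟩
    · rintro ⟨⟨m, hm⟩, hW, rfl⟩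
      exact ⟨⟨m, hZ.ge ⟨hW, hm⟩⟩, rfl⟩
  have hk : LinearMap.ker α = LinearMap.ker β := by
    rw [LinearMap.ker_comp, LinearMap.ker_comp, hφ, hφ']
    ext ⟨m, hm⟩
    exact ⟨fun h => (hB.le ⟨hm.1, h⟩).2, fun h => (hB.ge ⟨hm.1, h⟩).2⟩
  rw [← hα, ← hβ]
  exact ⟨α.quotKerEquivRange.symm ≪≫ₗ Submodule.quotEquivOfEq _ _ hk ≪≫ₗ β.quotKerEquivRange⟩

/-- An antitone sequence of subspaces stabilizes inside a finite dimensional one. -/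
theorem exists_inf_eq_iInf {F M : Type*} [Field F] [AddCommGroup M] [Module F M]
    (W : Submodule F M) [FiniteDimensional F W] {Z : ℕ → Submodule F M} (hZ : Antitone Z) :
    ∃ N, ∀ k ≥ N, W ⊓ Z k = W ⊓ ⨅ k, Z k := by
  obtain ⟨N, hN⟩ := IsArtinian.monotone_stabilizes (R := F) (M := W)
    ⟨fun k => OrderDual.toDual ((Z k).comap W.subtype), fun _ _ h => Submodule.comap_mono (hZ h)⟩
  refine ⟨N, fun k hk => le_antisymm ?_ (inf_le_inf_left _ (iInf_le _ k))⟩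
  rintro m ⟨hW, hm⟩
  refine ⟨hW, Submodule.mem_iInf _ |>.2 fun j => ?_⟩
  rcases le_total j k with h | h
  · exact hZ h hm
  · have h1 : (Z k).comap W.subtype = (Z j).comap W.subtype :=
      (hN k hk).symm.trans (hN j (hk.trans h))
    exact (h1.le : _) (show (⟨m, hW⟩ : W) ∈ (Z k).comap W.subtype from hm)

/-- A monotone sequence of subspaces stabilizes inside a finite dimensional one. -/
theorem exists_inf_eq_iSup {F M : Type*} [Field F] [AddCommGroup M] [Module F M]
    (W : Submodule F M) [FiniteDimensional F W] {B : ℕ → Submodule F M} (hB : Monotone B) :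
    ∃ N, ∀ k ≥ N, W ⊓ B k = W ⊓ ⨆ k, B k := by
  obtain ⟨N, hN⟩ := monotone_stabilizes_iff_noetherian.2 (inferInstance : IsNoetherian F W)
    ⟨fun k => (B k).comap W.subtype, fun _ _ h => Submodule.comap_mono (hB h)⟩
  refine ⟨N, fun k hk => le_antisymm (inf_le_inf_left _ (le_iSup B k)) ?_⟩
  rintro m ⟨hW, hm⟩
  obtain ⟨j, hj⟩ := (Submodule.mem_iSup_of_directed _ hB.directed_le).1 hm
  refine ⟨hW, ?_⟩
  rcases le_total j k with h | h
  · exact hB h hj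
  · have h1 : (B k).comap W.subtype = (B j).comap W.subtype :=
      (hN k hk).symm.trans (hN j (hk.trans h))
    exact (h1.ge : _) (show (⟨m, hW⟩ : W) ∈ (B j).comap W.subtype from hj)

/-! ### Local collapse and the limit page -/

namespace ExactCouple

variable {F : Type u} [Field F]

/-- Survivors decrease and boundaries increase, so their traces on a finite dimensional component
both become constant, equal to the traces of `Z^∞` and `B^∞`. -/
theorem exists_page_equiv_grEInf (C : ExactCouple.{u, v} F) (i : ℤ × ℤ)
    [FiniteDimensional F (C.grE i)] :
    ∃ r₀ : ℕ, 1 ≤ r₀ ∧ ∀ r > r₀, Nonempty ((C.page r).grE i ≃ₗ[F] C.grEInf i) := by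
  obtain ⟨N, hN⟩ := exists_inf_eq_iInf (C.grE i) C.cyc_antitone
  obtain ⟨N', hN'⟩ := exists_inf_eq_iSup (C.grE i) C.bdy_monotone
  -- Page `r` is derived `r - 1` times, so both bounds must hold at index `r - 1`.
  refine ⟨N + N' + 1, by omega, fun r hr => ?_⟩
  obtain ⟨φ, hker, hgr⟩ := exists_cyc_to_page (r - 1) C
  have := nonempty_equiv_of_inf_eq (W := C.grE i) hker
    (φ' := (C.bdyInf.comap C.cycInf.subtype).mkQ) (Submodule.ker_mkQ _)
    (hN _ (by omega)) (hN' _ (by omega))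
  rw [hgr i] at this
  exact this

/-- If `A` is bounded below in each row and `f` has degree `(0, 1)`, then the permanent cycles
are the kernel of `h`. -/
theorem mem_cycInf (C : ExactCouple.{u, v} F)
    (hf : ∀ n s, ∀ a ∈ C.grA (n, s), C.f a ∈ C.grA (n, s + 1))
    (hb : ∀ n, ∃ b : ℤ, ∀ s < b, C.grA (n, s) = ⊥) (e : C.E) : e ∈ C.cycInf ↔ C.h e = 0 := by
  constructor
  · intro he
    refine eq_zero_of_gradedComponent C.internalA ?_
    rintro ⟨n, s⟩
    obtain ⟨b, hb⟩ := hb n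
    -- The exponent puts the source degree strictly below `b`: the component of `h e` in degree `s`
    -- is a power of `f` applied to a component of `a` that vanishes.
    obtain ⟨a, ha⟩ := (mem_cyc ((s - b).toNat + 1) C e).1 ((Submodule.mem_iInf _).1 he _)
    have h1 := gradedComponent_shift_pow C.internalA hf n (s - ((s - b).toNat + 1 : ℕ))
      ((s - b).toNat + 1) a
    have h2 := gradedComponent_mem C.internalA (n, s - ((s - b).toNat + 1 : ℕ)) a
    rw [hb _ (by omega), Submodule.mem_bot] at h2
    rwa [h2, map_zero, ha, sub_add_cancel] at h1
  · intro he
    exact (Submodule.mem_iInf _).2 fun k => (mem_cyc k C e).2 ⟨0, by rw [map_zero, he]⟩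

/-- `E^(∞)` is the quotient of `A` by `f A` and the `f`-power torsion. -/
theorem exists_to_EInf (C : ExactCouple.{u, v} F)
    (hf : ∀ n s, ∀ a ∈ C.grA (n, s), C.f a ∈ C.grA (n, s + 1))
    (hg : ∀ i, ∀ a ∈ C.grA i, C.g a ∈ C.grE i)
    (hb : ∀ n, ∃ b : ℤ, ∀ s < b, C.grA (n, s) = ⊥) :
    ∃ γ : C.A →ₗ[F] C.EInf, Function.Surjective γ ∧
      (∀ a, γ a = 0 ↔ ∃ (k : ℕ) (t b : C.A), (C.f ^ k) t = 0 ∧ a = t + C.f b) ∧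
      ∀ i, (C.grA i).map γ = C.grEInf i := by
  have hgc : ∀ a, C.g a ∈ C.cycInf := fun a => (C.mem_cycInf hf hb _).2 (C.h_g a)
  have hγ0 : ∀ i, C.grEInf i ≤
      (C.grA i).map ((C.bdyInf.comap C.cycInf.subtype).mkQ ∘ₗ C.g.codRestrict C.cycInf hgc) := by
    rintro i _ ⟨⟨e, he⟩, hei, rfl⟩
    obtain ⟨a, rfl⟩ := (C.exact_gh e).1 ((C.mem_cycInf hf hb e).1 he)
    have hei' : C.g a ∈ C.grE i := hei
    -- The preimage `a` of `e` need not be homogeneous, but `g` preserves degrees, so its component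
    -- of degree `i` has the same image.
    refine ⟨gradedComponent C.internalA i a, gradedComponent_mem C.internalA i a, ?_⟩
    refine congrArg (C.bdyInf.comap C.cycInf.subtype).mkQ (Subtype.ext ?_)
    change C.g (gradedComponent C.internalA i a) = C.g a
    rw [← gradedComponent_map C.internalA C.internalE Function.injective_id hg, id,
      gradedComponent_of_mem C.internalE hei']
  refine ⟨(C.bdyInf.comap C.cycInf.subtype).mkQ ∘ₗ C.g.codRestrict C.cycInf hgc, ?_, ?_,
    fun i => le_antisymm ?_ (hγ0 i)⟩
  · intro q
    obtain ⟨⟨e, he⟩, rfl⟩ := Submodule.mkQ_surjective _ q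
    obtain ⟨a, rfl⟩ := (C.exact_gh e).1 ((C.mem_cycInf hf hb e).1 he)
    exact ⟨a, rfl⟩
  · intro a
    refine (Submodule.Quotient.mk_eq_zero _).trans ((C.mem_bdyInf (C.g a)).trans ?_)
    constructor
    · rintro ⟨k, hk⟩
      obtain ⟨t, ht, hta⟩ := (mem_bdy k C _).1 hk
      obtain ⟨b, hb⟩ := (C.exact_fg (a - t)).1 (by rw [map_sub, hta, sub_self])
      exact ⟨k, t, b, ht, by rw [hb]; abel⟩
    · rintro ⟨k, t, b, ht, rfl⟩
      exact ⟨k, (mem_bdy k C _).2 ⟨t, ht, by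
        rw [map_add, C.exact_fg.apply_apply_eq_zero, add_zero]⟩⟩
  · rintro _ ⟨a, ha, rfl⟩
    exact ⟨⟨C.g a, hgc a⟩, hg i a ha, rfl⟩

end ExactCouple

/-! ### Graded and filtered pieces of homology -/

theorem homolPart_bot {F M : Type*} [Field F] [AddCommGroup M] [Module F M] (d : M →ₗ[F] M) :
    homolPart d ⊥ = ⊥ := by
  rw [eq_bot_iff]
  rintro _ ⟨⟨m, hm⟩, h0, rfl⟩
  have h0' : m = 0 := h0
  subst h0'
  exact (Submodule.Quotient.mk_eq_zero _).2 (Submodule.zero_mem _)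

theorem homolPart_mono {F M : Type*} [Field F] [AddCommGroup M] [Module F M] (d : M →ₗ[F] M)
    {P P' : Submodule F M} (h : P ≤ P') : homolPart d P ≤ homolPart d P' :=
  Submodule.map_mono (Submodule.comap_mono h)

theorem finiteDimensional_homolPart {F M : Type*} [Field F] [AddCommGroup M] [Module F M]
    (d : M →ₗ[F] M) (P : Submodule F M) [FiniteDimensional F P] :
    FiniteDimensional F (homolPart d P) := by
  have : FiniteDimensional F ↥(P.comap (LinearMap.ker d).subtype) :=
    Module.Finite.of_injective (((LinearMap.ker d).subtype).restrict
      (p := P.comap (LinearMap.ker d).subtype) (q := P) fun _ h => h) fun a b h =>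
        Subtype.ext (Subtype.ext (congrArg (fun x : ↥P => (x : M)) h))
  exact Module.Finite.map _ _

namespace FilteredComplex

variable {F C : Type*} [Field F] [AddCommGroup C] [Module F C]

theorem mem_hom (𝒞 : FilteredComplex F C) (n : ℤ) (c : C) :
    c ∈ 𝒞.hom n ↔ ∃ p, c ∈ 𝒞.fil p n := by
  rw [← 𝒞.fil_exhaustive n]
  exact Submodule.mem_iSup_of_directed _ (𝒞.fil_mono n).directed_le

/-- A cycle in `Cₙ` already lies in some `𝓕ᵖCₙ`, so the induced filtration of homology is exhaustive
as well. -/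
theorem homolPart_hom (𝒞 : FilteredComplex F C) (n : ℤ) :
    homolPart 𝒞.d (𝒞.hom n) = ⨆ p, homolPart 𝒞.d (𝒞.fil p n) := by
  apply le_antisymm
  · rintro _ ⟨⟨c, hc⟩, hcn, rfl⟩
    obtain ⟨p, hp⟩ := (𝒞.mem_hom n c).1 hcn
    exact Submodule.mem_iSup_of_mem p ⟨⟨c, hc⟩, hp, rfl⟩
  · exact iSup_le fun p => homolPart_mono _ fun c hc => (𝒞.mem_hom n c).2 ⟨p, hc⟩

theorem iSup_homolPart_hom (𝒞 : FilteredComplex F C) : ⨆ n, homolPart 𝒞.d (𝒞.hom n) = ⊤ :=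
  (homol_internal 𝒞.internal ⟨-1, fun n v hv => by
    rw [← sub_eq_add_neg]; exact 𝒞.d_mem n v hv⟩).submodule_iSup_eq_top

end FilteredComplex

/-! ### Homology of `K/(X-1)K` and the limit isomorphism -/

namespace GradedComplex

section

variable {F : Type u} {K : Type v} [Field F] [AddCommGroup K] [Module F K] [Module F[X] K]
  [IsScalarTower F F[X] K]

/-- The map `H(K) → H(K/(X-1)K)` induced by the projection. -/
noncomputable def toHomolModXSubOne (𝒦 : GradedComplex F K) :
    Homol 𝒦.d →ₗ[F] Homol 𝒦.modXSubOne.d :=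
  homolMap (mulRange F K (X - 1 : F[X])).mkQ fun _ => rfl

variable [Module.Free F[X] K]

theorem couple_f_mem (𝒦 : GradedComplex F K) (n s : ℤ) :
    ∀ a ∈ 𝒦.couple.grA (n, s), 𝒦.couple.f a ∈ 𝒦.couple.grA (n, s + 1) := by
  rintro _ ⟨⟨k, hk⟩, hm, rfl⟩
  exact ⟨_, 𝒦.X_mem n s k hm, rfl⟩

theorem couple_g_mem (𝒦 : GradedComplex F K) (i : ℤ × ℤ) :
    ∀ a ∈ 𝒦.couple.grA i, 𝒦.couple.g a ∈ 𝒦.couple.grE i := by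
  rintro _ ⟨⟨k, hk⟩, hm, rfl⟩
  exact ⟨_, ⟨k, hm, rfl⟩, rfl⟩

theorem couple_grA_eq_bot {𝒦 : GradedComplex F K} (hb : 𝒦.BoundedBelow) (n : ℤ) :
    ∃ b : ℤ, ∀ s < b, 𝒦.couple.grA (n, s) = ⊥ := by
  obtain ⟨b, hb⟩ := hb n
  exact ⟨b, fun s hs => (congrArg (homolPart 𝒦.d) (hb s hs)).trans (homolPart_bot _)⟩

theorem finiteDimensional_couple_grE {𝒦 : GradedComplex F K} (hf : 𝒦.LocallyFinite) (n s : ℤ) :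
    FiniteDimensional F (𝒦.couple.grE (n, s)) := by
  have := hf n s
  have : FiniteDimensional F (𝒦.modX.gr (n, s)) := Module.Finite.map _ _
  exact finiteDimensional_homolPart _ _

variable (F K) in
theorem X_sub_one_injective :
    Function.Injective (Algebra.lsmul F F K (X - 1 : F[X])) :=
  smul_right_injective K (Polynomial.X_sub_C_ne_zero (1 : F))

/-- This is exactness at `H(K)` in the long exact sequence of `0 → K --(X-1)--> K → K/(X-1)K → 0`.
-/
theorem toHomolModXSubOne_eq_zero (𝒦 : GradedComplex F K) (a : 𝒦.couple.A) :
    𝒦.toHomolModXSubOne a = 0 ↔ ∃ b, a = 𝒦.couple.f b - b := by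
  obtain ⟨⟨z, hz⟩, rfl⟩ := Submodule.mkQ_surjective _ a
  have hz' : 𝒦.d z = 0 := hz
  constructor
  · intro h
    obtain ⟨y, hy⟩ := (Submodule.Quotient.mk_eq_zero _).1 h
    obtain ⟨y, rfl⟩ := Submodule.mkQ_surjective _ y
    have hy' : (Submodule.Quotient.mk (𝒦.d y) : K ⧸ mulRange F K (X - 1 : F[X])) =
      Submodule.Quotient.mk z := hy
    obtain ⟨m, hm⟩ := (Submodule.Quotient.eq _).1 hy'.symm
    have hm' : (X - 1 : F[X]) • m = z - 𝒦.d y := hm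
    -- `(X - 1) d m = d (z - d y) = 0`, and `X - 1` is injective.
    have hdm : 𝒦.d m = 0 := by
      apply X_sub_one_injective F K
      change (X - 1 : F[X]) • 𝒦.d m = (X - 1 : F[X]) • 0
      rw [← 𝒦.d_smul, hm', map_sub, 𝒦.d_d, hz', sub_zero, smul_zero]
    refine ⟨Submodule.Quotient.mk ⟨m, hdm⟩, (Submodule.Quotient.eq _).2 ⟨y, ?_⟩⟩
    change 𝒦.d y = z - ((X : F[X]) • m - m)
    rw [sub_smul, one_smul] at hm'
    rw [hm']; abel
  · rintro ⟨b, hb⟩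
    obtain ⟨⟨m, hdm⟩, rfl⟩ := Submodule.mkQ_surjective _ b
    rw [hb]
    refine (Submodule.Quotient.mk_eq_zero _).2 ⟨0, ?_⟩
    rw [map_zero]
    refine ((Submodule.Quotient.mk_eq_zero (mulRange F K (X - 1 : F[X]))).2 ⟨m, ?_⟩).symm
    change (X - 1 : F[X]) • m = (X : F[X]) • m - m
    rw [sub_smul, one_smul]

/-- A cycle of `K/(X-1)K` in filtration `p` lifts to a homogeneous `c` with `d c = (X - 1) m`. As `d
c` is homogeneous, `m = 0`, so `c` is already a cycle in `K`. In particular no class is lost in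
passing from `H(K)` to `H(K/(X-1)K)`. -/
theorem map_toHomolModXSubOne (𝒦 : GradedComplex F K) (n p : ℤ) :
    (𝒦.couple.grA (n, p)).map 𝒦.toHomolModXSubOne =
      homolPart 𝒦.modXSubOne.d (𝒦.modXSubOne.fil p n) := by
  apply le_antisymm
  · rintro _ ⟨_, ⟨⟨z, hz⟩, hzp, rfl⟩, rfl⟩
    exact ⟨_, ⟨z, hzp, rfl⟩, rfl⟩
  · rintro _ ⟨⟨_, hc⟩, ⟨c, hcp, rfl⟩, rfl⟩
    have hcp' : c ∈ 𝒦.gr (n, p) := hcp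
    obtain ⟨m, hm⟩ := (Submodule.Quotient.mk_eq_zero (mulRange F K (X - 1 : F[X]))).1 hc
    have hm' : (X - 1 : F[X]) • m = 𝒦.d c := hm
    rw [sub_smul, one_smul] at hm'
    have hm0 : m = 0 := by
      refine eq_zero_of_sub_one_homogeneous 𝒦.internal (f := Algebra.lsmul F F K (X : F[X]))
        𝒦.X_mem (X_injective F K) (n := n - 1) (p := p) ?_
      change (X : F[X]) • m - m ∈ _
      rw [hm']
      exact 𝒦.d_mem n p c hcp'
    rw [hm0, smul_zero, sub_zero] at hm'
    exact ⟨_, ⟨⟨c, hm'.symm⟩, hcp', rfl⟩, rfl⟩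

/-- The comparison of `A / (T + f A)` with `A / (f - 1) A` supplies injectivity and the filtration.
Surjectivity and the homological grading follow from the filtration, since it is exhaustive in each
`Hₙ`. -/
theorem exists_EInf_equiv {𝒦 : GradedComplex F K} (hb : 𝒦.BoundedBelow) :
    ∃ e : 𝒦.couple.EInf ≃ₗ[F] Homol 𝒦.modXSubOne.d,
      (∀ n, (⨆ s, 𝒦.couple.grEInf (n, s)).map e.toLinearMap =
        homolPart 𝒦.modXSubOne.d (𝒦.modXSubOne.hom n)) ∧
      ∀ p n, (⨆ s, ⨆ _ : s ≤ p, 𝒦.couple.grEInf (n, s)).map e.toLinearMap =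
        homolPart 𝒦.modXSubOne.d (𝒦.modXSubOne.fil p n) := by
  obtain ⟨γ, hγ, hγker, hγgr⟩ := 𝒦.couple.exists_to_EInf 𝒦.couple_f_mem 𝒦.couple_g_mem
    (couple_grA_eq_bot hb)
  obtain ⟨e, he, hefil⟩ := exists_graded_to_filtered 𝒦.couple.internalA 𝒦.couple_f_mem
    (couple_grA_eq_bot hb) hγ hγker (ι := 𝒦.toHomolModXSubOne) 𝒦.toHomolModXSubOne_eq_zero
  have hfil : ∀ p n, (⨆ s, ⨆ _ : s ≤ p, 𝒦.couple.grEInf (n, s)).map e =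
      homolPart 𝒦.modXSubOne.d (𝒦.modXSubOne.fil p n) := by
    intro p n
    have h := hefil p n
    simp only [hγgr] at h
    exact h.trans (𝒦.map_toHomolModXSubOne n p)
  have hhom : ∀ n, (⨆ s, 𝒦.couple.grEInf (n, s)).map e =
      homolPart 𝒦.modXSubOne.d (𝒦.modXSubOne.hom n) := by
    intro n
    rw [FilteredComplex.homolPart_hom, ← iSup_congr fun p => hfil p n, ← Submodule.map_iSup]
    congr 1
    exact le_antisymm
      (iSup_le fun s => le_iSup_of_le s (le_iSup₂_of_le s le_rfl le_rfl))
      (iSup_le fun p => iSup₂_le fun s _ => le_iSup (fun s => 𝒦.couple.grEInf (n, s)) s)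
  have hsurj : Function.Surjective e := by
    rw [← LinearMap.range_eq_top, eq_top_iff, ← FilteredComplex.iSup_homolPart_hom]
    exact iSup_le fun n => (hhom n).ge.trans LinearMap.map_le_range
  exact ⟨LinearEquiv.ofBijective e ⟨he, hsurj⟩, hhom, hfil⟩

end

end GradedComplex

/-! ### A criterion for freeness -/

/-- A graded `F[X]`-module that is bounded below in each row and on which `X` acts injectively is
free. -/
theorem free_of_graded {F K : Type*} [Field F] [AddCommGroup K] [Module F K] [Module F[X] K]
    [IsScalarTower F F[X] K] {G : ℤ × ℤ → Submodule F K} (hG : DirectSum.IsInternal G)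
    (hX : ∀ n s, ∀ v ∈ G (n, s), (X : F[X]) • v ∈ G (n, s + 1))
    (hinj : Function.Injective (Algebra.lsmul F F K (X : F[X])))
    (hb : ∀ n, ∃ b : ℤ, ∀ s < b, G (n, s) = ⊥) : Module.Free F[X] K := by
  let γ := (GradedComplex.mulRange F K (X : F[X])).mkQ
  have hγ0 : ∀ v, γ v = 0 ↔ ∃ m, (X : F[X]) • m = v := fun v => Submodule.Quotient.mk_eq_zero _
  have hcomp := gradedComponent_shift hG (f := Algebra.lsmul F F K (X : F[X])) hX
  have hQ := internal_map hG (γ := γ) (Submodule.mkQ_surjective _) (by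
    rintro _ hm ⟨n, s⟩
    obtain ⟨m, rfl⟩ := (hγ0 _).1 hm
    have h := hcomp n (s - 1) m
    rw [sub_add_cancel] at h
    exact (hγ0 _).2 ⟨_, h.symm⟩)
  obtain ⟨σ, hσ, hσG⟩ := exists_graded_section hQ
  -- On `K/XK` a polynomial acts through its constant term.
  have hγp : ∀ (p : F[X]) v, γ (p • v) = p.coeff 0 • γ v := by
    intro p v
    rw [← map_smul, ← sub_eq_zero, ← map_sub, hγ0]
    refine ⟨p.divX • v, ?_⟩
    conv_rhs => rw [← p.divX_mul_X_add]
    rw [add_smul, mul_comm, mul_smul, C_eq_algebraMap, algebraMap_smul]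
    simp
  -- The basis need not be homogeneous: only the section `σ` has to respect degrees.
  let b := Module.Basis.ofVectorSpace F (K ⧸ GradedComplex.mulRange F K (X : F[X]))
  -- Applying `γ` to a relation shows that the constant terms vanish. The relation can then be
  -- divided by `X`, which acts injectively, and the argument repeats, so every power of `X` divides
  -- the coefficients.
  have hdvd : ∀ (k : ℕ) (t : Finset _) (g : _ → F[X]), ∑ i ∈ t, g i • σ (b i) = 0 →
      ∀ i ∈ t, (X : F[X]) ^ k ∣ g i := by
    intro k t
    induction k with
    | zero => exact fun g _ i _ => by simp
    | succ k ih =>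
      intro g hg
      have hc : ∀ i ∈ t, (g i).coeff 0 = 0 := by
        refine linearIndependent_iff'.1 b.linearIndependent t _ ?_
        have := congrArg γ hg
        rw [map_sum, map_zero] at this
        rw [← this]
        exact Finset.sum_congr rfl fun i _ => by rw [hγp, hσ]
      have hdiv : ∀ i ∈ t, X * (g i).divX = g i := fun i hi => by
        conv_rhs => rw [← (g i).divX_mul_X_add, hc i hi, map_zero, add_zero]
        rw [mul_comm]
      intro i hi
      rw [← hdiv i hi, pow_succ']
      refine mul_dvd_mul_left _ (ih (fun i => (g i).divX) (hinj ?_) i hi)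
      rw [map_zero, ← hg]
      change (X : F[X]) • ∑ j ∈ t, (g j).divX • σ (b j) = _
      rw [Finset.smul_sum]
      exact Finset.sum_congr rfl fun j hj => by rw [← mul_smul, hdiv j hj]
  have hli : LinearIndependent F[X] fun i => σ (b i) := by
    rw [linearIndependent_iff']
    intro t g hg i hi
    ext d
    exact X_pow_dvd_iff.1 (hdvd (d + 1) t g hg i hi) d (Nat.lt_succ_self d)
  have hσspan : ∀ q, σ q ∈ Submodule.span F[X] (Set.range fun i => σ (b i)) := by
    intro q
    have hle : Submodule.span F (Set.range b) ≤
        ((Submodule.span F[X] (Set.range fun i => σ (b i))).restrictScalars F).comap σ := by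
      rw [Submodule.span_le]
      rintro _ ⟨i, rfl⟩
      exact Submodule.subset_span ⟨i, rfl⟩
    exact hle (by rw [b.span_eq]; trivial)
  refine Module.Free.of_basis (Module.Basis.mk hli fun v _ => ?_)
  obtain ⟨t, -, hv⟩ := exists_eq_sum_gradedComponent hG v
  rw [hv]
  refine Submodule.sum_mem _ ?_
  rintro ⟨n, s⟩ -
  obtain ⟨c, hc⟩ := hb n
  -- Induction on the degree, from `c - 1`, where the component is zero. The difference `v - σ (γ
  -- v)` is homogeneous and equals `X • m`, and `m` may be replaced by its component one degree
  -- lower.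
  have main : ∀ k : ℕ, ∀ v ∈ G (n, c - 1 + k),
      v ∈ Submodule.span F[X] (Set.range fun i => σ (b i)) := by
    intro k
    induction k with
    | zero =>
      intro v hv
      rw [hc _ (by simp), Submodule.mem_bot] at hv
      rw [hv]
      exact Submodule.zero_mem _
    | succ k ih =>
      intro v hv
      have h0 : γ (v - σ (γ v)) = 0 := by rw [map_sub, hσ, sub_self]
      obtain ⟨m, hm⟩ := (hγ0 _).1 h0
      have hmem := Submodule.sub_mem _ hv (hσG _ _ (Submodule.mem_map_of_mem hv))
      have hm' := hcomp n (c - 1 + k) m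
      have hm2 : Algebra.lsmul F F K (X : F[X]) m = v - σ (γ v) := hm
      rw [hm2, add_assoc, ← Nat.cast_succ, gradedComponent_of_mem hG hmem] at hm'
      rw [← sub_add_cancel v (σ (γ v)), hm']
      exact Submodule.add_mem _ (Submodule.smul_mem _ _ (ih _ (gradedComponent_mem hG _ m)))
        (hσspan _)
  rcases lt_or_ge s c with h | h
  · have := gradedComponent_mem hG (n, s) v
    rw [hc s h, Submodule.mem_bot] at this
    rw [this]
    exact Submodule.zero_mem _
  · refine main (s - (c - 1)).toNat _ ?_
    rw [Int.toNat_of_nonneg (by linarith), show c - 1 + (s - (c - 1)) = s by ring]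
    exact gradedComponent_mem hG _ v

/-! ### Recognizing isomorphisms of complexes -/

/-- A map of bigraded complexes is an isomorphism if it is so on the components. -/
theorem BigradedComplex.isomorphic_of_map {F V W : Type*} [Field F] [AddCommGroup V] [Module F V]
    [AddCommGroup W] [Module F W] {𝒱 : BigradedComplex F V} {𝒲 : BigradedComplex F W}
    (φ : V →ₗ[F] W) (hd : ∀ v, φ (𝒱.d v) = 𝒲.d (φ v)) (hgr : ∀ i, (𝒱.gr i).map φ = 𝒲.gr i)
    (h0 : ∀ i, ∀ v ∈ 𝒱.gr i, φ v = 0 → v = 0) : 𝒱.Isomorphic 𝒲 :=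
  ⟨LinearEquiv.ofBijective φ
    ⟨injective_of_graded 𝒱.internal 𝒲.internal Function.injective_id
      (fun i _ hv => (hgr i).le (Submodule.mem_map_of_mem hv)) h0,
    surjective_of_graded 𝒲.internal fun i => (hgr i).ge⟩, hd, hgr⟩

/-- A graded chain map on `K` that kills `XK` and is onto with kernel in `XK` on each component
identifies `K/XK` with its target. -/
theorem GradedComplex.modX_isomorphic_of_map {F K W : Type*} [Field F] [AddCommGroup K]
    [Module F K] [Module F[X] K] [IsScalarTower F F[X] K] [AddCommGroup W] [Module F W]
    {𝒦 : GradedComplex F K} {𝒲 : BigradedComplex F W} (ψ : K →ₗ[F] W)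
    (hX : ∀ k, ψ ((X : F[X]) • k) = 0) (hd : ∀ k, ψ (𝒦.d k) = 𝒲.d (ψ k))
    (hgr : ∀ i, (𝒦.gr i).map ψ = 𝒲.gr i)
    (h0 : ∀ i, ∀ k ∈ 𝒦.gr i, ψ k = 0 → ∃ m, (X : F[X]) • m = k) : 𝒦.modX.Isomorphic 𝒲 := by
  have hle : mulRange F K (X : F[X]) ≤ LinearMap.ker ψ := by
    rintro _ ⟨k, rfl⟩
    exact hX k
  refine BigradedComplex.isomorphic_of_map (Submodule.liftQ _ ψ hle) ?_ (fun i => ?_) ?_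
  · intro q
    obtain ⟨k, rfl⟩ := Submodule.mkQ_surjective _ q
    exact hd k
  · rw [← hgr i]
    change ((𝒦.gr i).map (mulRange F K X).mkQ).map _ = _
    rw [← Submodule.map_comp, Submodule.liftQ_mkQ]
  · rintro i _ ⟨k, hk, rfl⟩ h
    exact (Submodule.Quotient.mk_eq_zero _).2 (h0 i k hk h)

/-! ### Persistent complex of a filtered complex -/

namespace FilteredComplex

/-- A map of filtered complexes is an isomorphism if it is so on the steps of the filtrations. -/
theorem isomorphic_of_map {F V W : Type*} [Field F] [AddCommGroup V] [Module F V]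
    [AddCommGroup W] [Module F W] {𝒱 : FilteredComplex F V} {𝒲 : FilteredComplex F W}
    (φ : V →ₗ[F] W) (hd : ∀ v, φ (𝒱.d v) = 𝒲.d (φ v))
    (hfil : ∀ p n, (𝒱.fil p n).map φ = 𝒲.fil p n)
    (h0 : ∀ p n, ∀ v ∈ 𝒱.fil p n, φ v = 0 → v = 0) : 𝒱.Isomorphic 𝒲 := by
  have hhom : ∀ n, (𝒱.hom n).map φ = 𝒲.hom n := by
    intro n
    rw [← 𝒱.fil_exhaustive, ← 𝒲.fil_exhaustive, Submodule.map_iSup]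
    exact iSup_congr fun p => hfil p n
  refine ⟨LinearEquiv.ofBijective φ
    ⟨injective_of_graded 𝒱.internal 𝒲.internal Function.injective_id
      (fun n _ hv => (hhom n).le (Submodule.mem_map_of_mem hv)) fun n v hv hv0 => ?_,
    surjective_of_graded 𝒲.internal fun n => (hhom n).ge⟩, hd, hhom, hfil⟩
  obtain ⟨p, hp⟩ := (𝒱.mem_hom n v).1 hv
  exact h0 p n v hp hv0

variable {F C : Type*} [Field F] [AddCommGroup C] [Module F C] (𝒞 : FilteredComplex F C)

/-- The inclusion of `𝓕ᵖCₙ` as a summand of `⨁ₚ 𝓕ᵖC`, for `i = (n, p)`. -/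
noncomputable abbrev incl (i : ℤ × ℤ) : ↥(𝒞.fil i.2 i.1) →ₗ[F] 𝒞.Sum :=
  DirectSum.lof F (ℤ × ℤ) (fun i => ↥(𝒞.fil i.2 i.1)) i

theorem incl_injective (i : ℤ × ℤ) : Function.Injective (𝒞.incl i) :=
  DirectSum.of_injective (β := fun i : ℤ × ℤ => ↥(𝒞.fil i.2 i.1)) i

/-- Bidegrees such as `(n, p - 1 + 1)` and `(n, p)` are equal only propositionally; this moves a
vector between the corresponding summands. -/
theorem incl_congr {i j : ℤ × ℤ} (hij : i = j) {v : ↥(𝒞.fil i.2 i.1)} {w : ↥(𝒞.fil j.2 j.1)}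
    (h : (v : C) = w) : 𝒞.incl i v = 𝒞.incl j w := by
  subst hij
  rw [Subtype.ext h]

/-- Each summand is included in the next, and distinct summands have distinct targets. -/
theorem shift_injective : Function.Injective 𝒞.shift := by
  refine injective_of_graded 𝒞.sum_internal 𝒞.sum_internal up_injective ?_ ?_
  · rintro i _ ⟨v, rfl⟩
    rw [shift_lof]
    exact ⟨_, rfl⟩
  · rintro i _ ⟨v, rfl⟩ h
    rw [shift_lof] at h
    have h1 := 𝒞.incl_injective _ (h.trans (map_zero (𝒞.incl (i.1, i.2 + 1))).symm)
    have h2 : v = 0 := Subtype.ext (congrArg (fun x : ↥(𝒞.fil (i.2 + 1) i.1) => (x : C)) h1)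
    rw [h2, map_zero]

variable {𝒞} in
theorem pers_boundedBelow (hb : 𝒞.BoundedBelow) : 𝒞.pers.BoundedBelow := by
  intro n
  obtain ⟨b, hb⟩ := hb n
  refine ⟨b, fun s hs => eq_bot_iff.2 ?_⟩
  rintro _ ⟨_, ⟨v, rfl⟩, rfl⟩
  have h1 : (v : C) ∈ 𝒞.fil b n := 𝒞.fil_mono n hs.le v.2
  rw [hb, Submodule.mem_bot] at h1
  have h2 : v = 0 := Subtype.ext h1
  rw [h2, map_zero, map_zero]
  exact Submodule.zero_mem _

variable {𝒞} in
theorem pers_locallyFinite (hf : 𝒞.LocallyFinite) : 𝒞.pers.LocallyFinite := by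
  intro n s
  have := hf s n
  have : FiniteDimensional F ↥(LinearMap.range (𝒞.incl (n, s))) := Module.Finite.range _
  exact Module.Finite.map _ _

variable {𝒞} in
theorem pers_free (hb : 𝒞.BoundedBelow) : Module.Free F[X] 𝒞.Pers := by
  refine free_of_graded 𝒞.pers.internal 𝒞.pers.X_mem ?_ (pers_boundedBelow hb)
  intro a b h
  obtain ⟨v, rfl⟩ := 𝒞.toPers.surjective a
  obtain ⟨w, rfl⟩ := 𝒞.toPers.surjective b
  have h' : (X : F[X]) • 𝒞.toPers v = (X : F[X]) • 𝒞.toPers w := h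
  rw [X_smul_toPers, X_smul_toPers] at h'
  rw [𝒞.shift_injective (𝒞.toPers.injective h')]

/-- The projection of `⨁ₚ 𝓕ᵖC` to the associated graded space. -/
noncomputable def sumToGr : 𝒞.Sum →ₗ[F] ⨁ i, 𝒞.GrPiece i :=
  DirectSum.toModule F (ℤ × ℤ) _ fun i =>
    DirectSum.lof F (ℤ × ℤ) 𝒞.GrPiece i ∘ₗ Submodule.mkQ _

theorem sumToGr_incl (i : ℤ × ℤ) (v : 𝒞.fil i.2 i.1) :
    𝒞.sumToGr (𝒞.incl i v) = DirectSum.lof F (ℤ × ℤ) 𝒞.GrPiece i (Submodule.Quotient.mk v) :=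
  DirectSum.toModule_lof _ _ _

theorem sumToGr_shift (v : 𝒞.Sum) : 𝒞.sumToGr (𝒞.shift v) = 0 := by
  suffices h : 𝒞.sumToGr ∘ₗ 𝒞.shift = 0 from LinearMap.congr_fun h v
  refine DirectSum.linearMap_ext F fun i => LinearMap.ext fun v => ?_
  simp only [LinearMap.comp_apply, shift_lof, LinearMap.zero_apply]
  refine (𝒞.sumToGr_incl (i.1, i.2 + 1) _).trans ?_
  rw [(Submodule.Quotient.mk_eq_zero _).2, map_zero]
  change (v : C) ∈ 𝒞.fil (i.2 + 1 - 1) i.1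
  rw [add_sub_cancel_right]
  exact v.2

theorem sumToGr_dSum (v : 𝒞.Sum) : 𝒞.sumToGr (𝒞.dSum v) = 𝒞.dGr (𝒞.sumToGr v) := by
  suffices h : 𝒞.sumToGr ∘ₗ 𝒞.dSum = 𝒞.dGr ∘ₗ 𝒞.sumToGr from LinearMap.congr_fun h v
  refine DirectSum.linearMap_ext F fun i => LinearMap.ext fun v => ?_
  simp only [LinearMap.comp_apply, dSum_lof]
  refine (𝒞.sumToGr_incl (i.1 - 1, i.2) _).trans ?_
  rw [sumToGr_incl, dGr_lof]
  rfl

/-- A vector of `𝓕ᵖCₙ` with zero class lies in `𝓕ᵖ⁻¹Cₙ`, so it is the shift of its own copy in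
degree `p - 1`. -/
theorem sumToGr_incl_eq_zero (i : ℤ × ℤ) (v : 𝒞.fil i.2 i.1) (h : 𝒞.sumToGr (𝒞.incl i v) = 0) :
    ∃ w, 𝒞.shift w = 𝒞.incl i v := by
  rw [sumToGr_incl] at h
  have h2 : (Submodule.Quotient.mk v : 𝒞.GrPiece i) = 0 :=
    DirectSum.of_injective (β := 𝒞.GrPiece) i (h.trans (map_zero _).symm)
  have h3 : (v : C) ∈ 𝒞.fil (i.2 - 1) i.1 :=
    (Submodule.Quotient.mk_eq_zero ((𝒞.fil (i.2 - 1) i.1).comap (𝒞.fil i.2 i.1).subtype)).1 h2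
  refine ⟨𝒞.incl (i.1, i.2 - 1) ⟨v, h3⟩, (𝒞.shift_lof (i.1, i.2 - 1) _).trans ?_⟩
  exact 𝒞.incl_congr (i := (i.1, i.2 - 1 + 1)) (j := i) (Prod.ext rfl (sub_add_cancel _ _)) rfl

theorem mem_pers_gr (i : ℤ × ℤ) (k : 𝒞.Pers) :
    k ∈ 𝒞.pers.gr i ↔ ∃ v, 𝒞.toPers (𝒞.incl i v) = k := by
  constructor
  · rintro ⟨_, ⟨v, rfl⟩, rfl⟩
    exact ⟨v, rfl⟩
  · rintro ⟨v, rfl⟩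
    exact ⟨_, ⟨v, rfl⟩, rfl⟩

theorem pers_modX_isomorphic : 𝒞.pers.modX.Isomorphic 𝒞.assocGr := by
  refine GradedComplex.modX_isomorphic_of_map
    (𝒞.sumToGr ∘ₗ 𝒞.toPers.symm.toLinearMap) ?_ ?_ (fun i => le_antisymm ?_ ?_) ?_
  · intro k
    obtain ⟨v, rfl⟩ := 𝒞.toPers.surjective k
    rw [X_smul_toPers]
    exact 𝒞.sumToGr_shift v
  · intro k
    obtain ⟨v, rfl⟩ := 𝒞.toPers.surjective k
    exact 𝒞.sumToGr_dSum v
  · rintro _ ⟨k, hk, rfl⟩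
    obtain ⟨v, rfl⟩ := (𝒞.mem_pers_gr i k).1 hk
    exact ⟨_, (𝒞.sumToGr_incl i v).symm⟩
  · rintro _ ⟨q, rfl⟩
    obtain ⟨v, rfl⟩ := Submodule.mkQ_surjective _ q
    exact ⟨_, (𝒞.mem_pers_gr i _).2 ⟨v, rfl⟩, 𝒞.sumToGr_incl i v⟩
  · intro i k hk h
    obtain ⟨v, rfl⟩ := (𝒞.mem_pers_gr i k).1 hk
    obtain ⟨w, hw⟩ := 𝒞.sumToGr_incl_eq_zero i v h
    exact ⟨𝒞.toPers w, by rw [X_smul_toPers, hw]⟩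

/-- The sum of the inclusions `𝓕ᵖCₙ → C`. -/
noncomputable def sumToC : 𝒞.Sum →ₗ[F] C :=
  DirectSum.toModule F (ℤ × ℤ) _ fun i => (𝒞.fil i.2 i.1).subtype

theorem sumToC_incl (i : ℤ × ℤ) (v : 𝒞.fil i.2 i.1) : 𝒞.sumToC (𝒞.incl i v) = v :=
  DirectSum.toModule_lof _ _ _

theorem sumToC_shift (v : 𝒞.Sum) : 𝒞.sumToC (𝒞.shift v) = 𝒞.sumToC v := by
  suffices h : 𝒞.sumToC ∘ₗ 𝒞.shift = 𝒞.sumToC from LinearMap.congr_fun h v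
  refine DirectSum.linearMap_ext F fun i => LinearMap.ext fun v => ?_
  simp only [LinearMap.comp_apply, shift_lof]
  refine (𝒞.sumToC_incl (i.1, i.2 + 1) _).trans ?_
  rw [sumToC_incl]
  rfl

theorem sumToC_dSum (v : 𝒞.Sum) : 𝒞.sumToC (𝒞.dSum v) = 𝒞.d (𝒞.sumToC v) := by
  suffices h : 𝒞.sumToC ∘ₗ 𝒞.dSum = 𝒞.d ∘ₗ 𝒞.sumToC from LinearMap.congr_fun h v
  refine DirectSum.linearMap_ext F fun i => LinearMap.ext fun v => ?_
  simp only [LinearMap.comp_apply, dSum_lof]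
  refine (𝒞.sumToC_incl (i.1 - 1, i.2) _).trans ?_
  rw [sumToC_incl]
  rfl

/-- Dividing by `X - 1` identifies the copies of a vector in all filtration levels that contain it,
leaving the union `C`. -/
theorem pers_modXSubOne_isomorphic : 𝒞.pers.modXSubOne.Isomorphic 𝒞 := by
  have hle : GradedComplex.mulRange F 𝒞.Pers (X - 1 : F[X]) ≤
      LinearMap.ker (𝒞.sumToC ∘ₗ 𝒞.toPers.symm.toLinearMap) := by
    rintro _ ⟨a, rfl⟩
    obtain ⟨v, rfl⟩ := 𝒞.toPers.surjective a
    have h : (X - 1 : F[X]) • 𝒞.toPers v = 𝒞.toPers (𝒞.shift v - v) := by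
      rw [sub_smul, one_smul, X_smul_toPers, map_sub]
    refine (congrArg (𝒞.sumToC ∘ₗ 𝒞.toPers.symm.toLinearMap) h).trans ?_
    change 𝒞.sumToC (𝒞.shift v - v) = 0
    rw [map_sub, sumToC_shift, sub_self]
  let φ : (𝒞.Pers ⧸ GradedComplex.mulRange F 𝒞.Pers (X - 1 : F[X])) →ₗ[F] C :=
    Submodule.liftQ _ _ hle
  refine isomorphic_of_map φ ?_ (fun p n => le_antisymm ?_ ?_) ?_
  · intro q
    obtain ⟨a, rfl⟩ := Submodule.mkQ_surjective _ q
    obtain ⟨v, rfl⟩ := 𝒞.toPers.surjective a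
    exact 𝒞.sumToC_dSum v
  · rintro _ ⟨_, ⟨_, ⟨_, ⟨v, rfl⟩, rfl⟩, rfl⟩, rfl⟩
    exact (𝒞.sumToC_incl (n, p) v).symm ▸ v.2
  · intro c hc
    exact ⟨_, ⟨_, ⟨_, ⟨⟨c, hc⟩, rfl⟩, rfl⟩, rfl⟩, 𝒞.sumToC_incl (n, p) ⟨c, hc⟩⟩
  -- Injectivity is needed only on a single filtration step. Its elements come from one summand,
  -- where the map to `C` is the inclusion, so the kernel of `sumToC` need not be determined.
  · rintro p n _ ⟨_, ⟨_, ⟨v, rfl⟩, rfl⟩, rfl⟩ h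
    have h1 : v = 0 := Subtype.ext ((𝒞.sumToC_incl (n, p) v).symm.trans h)
    rw [h1, map_zero, map_zero, map_zero]

end FilteredComplex

end PersistentSS

theorem mainTheorem6 {F : Type*} [Field F] :
    (∀ {K : Type*} [AddCommGroup K] [Module F K] [Module F[X] K] [IsScalarTower F F[X] K]
      [Module.Free F[X] K] (𝒦 : PersistentSS.GradedComplex F K),
      𝒦.BoundedBelow → 𝒦.LocallyFinite →
      -- `E^(1)(K) ≅ H(K/XK)` as bigraded vector spaces
      (∃ e : (𝒦.couple.page 1).E ≃ₗ[F] PersistentSS.Homol 𝒦.modX.d,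
        ∀ i, ((𝒦.couple.page 1).grE i).map e.toLinearMap =
          PersistentSS.homolPart 𝒦.modX.d (𝒦.modX.gr i)) ∧
      -- the spectral sequence collapses locally to `E^(∞)(K)`
      (∀ n s : ℤ, ∃ r₀ : ℕ, 1 ≤ r₀ ∧ ∀ r > r₀,
        Nonempty ((𝒦.couple.page r).grE (n, s) ≃ₗ[F] 𝒦.couple.grEInf (n, s))) ∧
      -- `E^(∞)(K) ≅ H(K/(X-1)K)`, compatibly with the homological gradings and with the
      -- filtrations by the internal degree
      (∃ e : 𝒦.couple.EInf ≃ₗ[F] PersistentSS.Homol 𝒦.modXSubOne.d,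
        (∀ n, (⨆ s, 𝒦.couple.grEInf (n, s)).map e.toLinearMap =
          PersistentSS.homolPart 𝒦.modXSubOne.d (𝒦.modXSubOne.hom n)) ∧
        ∀ p n, (⨆ s, ⨆ _ : s ≤ p, 𝒦.couple.grEInf (n, s)).map e.toLinearMap =
          PersistentSS.homolPart 𝒦.modXSubOne.d (𝒦.modXSubOne.fil p n))) ∧
    (∀ {C : Type*} [AddCommGroup C] [Module F C] (𝒞 : PersistentSS.FilteredComplex F C),
      𝒞.BoundedBelow → 𝒞.LocallyFinite →
      -- the persistent chain complex is a complex to which the first part applies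
      (Module.Free F[X] 𝒞.Pers ∧ 𝒞.pers.BoundedBelow ∧ 𝒞.pers.LocallyFinite) ∧
      𝒞.pers.modX.Isomorphic 𝒞.assocGr ∧
      𝒞.pers.modXSubOne.Isomorphic 𝒞) := by
  refine ⟨?_, ?_⟩
  · intro K _ _ _ _ _ 𝒦 hb hf
    -- The first page is the couple derived zero times, so its `E` is `H(K/XK)` by definition.
    refine ⟨⟨LinearEquiv.refl F _, fun i => Submodule.map_id _⟩, fun n s => ?_,
      PersistentSS.GradedComplex.exists_EInf_equiv hb⟩
    have := PersistentSS.GradedComplex.finiteDimensional_couple_grE hf n s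
    exact 𝒦.couple.exists_page_equiv_grEInf (n, s)
  · intro C _ _ 𝒞 hb hf
    exact ⟨⟨PersistentSS.FilteredComplex.pers_free hb,
      PersistentSS.FilteredComplex.pers_boundedBelow hb,
      PersistentSS.FilteredComplex.pers_locallyFinite hf⟩,
      𝒞.pers_modX_isomorphic, 𝒞.pers_modXSubOne_isomorphic⟩
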